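/- Let $k$ be a field and let $C/k$ be a smooth, projective, geometrically integral curve of genus $g = \dim_k H^1(C,\mathcal{O}_C)$ with function field $K=k(C)$. Let $\infty_1,\dots,\infty_m$ ($m\ge 1$) be distinct closed points of $C$, of degrees $d_j=[k(\infty_j):k]$, let $C^\circ = C\setminus\{\infty_1,\dots,\infty_m\}$, and let $R=k[C^\circ]$ be the ring of rational functions on $C$ that are regular away from $\infty_1,\dots,\infty_m$. For $x\in K$ put $\deg_j x=-d_j\,\mathrm{ord}_{\infty_j}(x)$ if $x\neq 0$, and $\deg_j 0=-\infty$. For a vector $v=(v_1,\dots,v_n)\in R^n$ put $$\deg v=\sum_{j=1}^m\max_{i}\deg_j v_i,$$ and for a quadratic form $f=\sum_{1\le i\le l\le n}a_{il}t_it_l\in R[t_1,\dots,t_n]$ put $$\deg f=\sum_{j=1}^m\max_{i\le l}\deg_j a_{il}.$$ Suppose that $f\in R[t_1,\dots,t_n]$ is a nonzero quadratic form which is isotropic, i.e. $f(w)=0$ for some nonzero $w\in R^n$. Then there is a nonzero $v\in R^n$ with $f(v)=0$ and $$\deg v\le\Bigl(\sum_{j=1}^m d_j+g-1\Bigr)n+\frac{n-1}{2}\deg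 f.$$ -/

import Mathlib

open AlgebraicGeometry CategoryTheory

universe u

/-- A nice curve over a field `k`: a scheme over `Spec k` which is smooth of relative dimension `1`,
proper and geometrically integral over `k`. (A projective scheme is proper; conversely, every proper
curve over a field is projective.) -/
structure NiceCurve (k : Type u) [Field k] where
  /-- the underlying scheme -/
  X : Scheme.{u}
  /-- the structure morphism -/
  hom : X ⟶ Spec (CommRingCat.of k)
  smooth : SmoothOfRelativeDimension 1 hom
  proper : IsProper hom
  geomIntegral : GeometricallyIntegral hom

namespace NiceCurve

noncomputable section

variable {k : Type u} [Field k] (C : NiceCurve k)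

instance instIsIntegral : IsIntegral C.X :=
  haveI := C.geomIntegral
  GeometricallyIntegral.isIntegral_of_subsingleton C.hom

instance instIsLocallyNoetherian : IsLocallyNoetherian C.X :=
  haveI := C.proper
  LocallyOfFiniteType.isLocallyNoetherian C.hom

/-- The function field `K = k(C)`, the stalk of the structure sheaf at the generic point. -/
abbrev K : Type u := C.X.functionField

/-- A constant as a global section of the structure sheaf. -/
def globalConst : k →+* Γ(C.X, ⊤) :=
  C.hom.appTop.hom.comp (Scheme.ΓSpecIso (CommRingCat.of k)).inv.hom

instance instAlgebra : Algebra k C.K :=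
  ((C.X.presheaf.germ ⊤ (genericPoint C.X) trivial).hom.comp C.globalConst).toAlgebra

/-- The closed points of the curve. -/
abbrev ClosedPoint : Type u := {x : C.X // IsClosed {x}}

variable {C}

/-- The degree `[k(P) : k]` of a closed point. -/
def ClosedPoint.degree (P : C.ClosedPoint) : ℕ := C.hom.residueDegree P.1

/-- The local ring `R_P` of the curve at a closed point `P`, as a `k`-subalgebra of the function
field. -/
def ClosedPoint.localRing (P : C.ClosedPoint) : Subalgebra k C.K where
  __ := (algebraMap (C.X.presheaf.stalk P.1) C.K).range
  algebraMap_mem' c := by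
    refine ⟨C.X.presheaf.germ ⊤ P.1 trivial (C.globalConst c), ?_⟩
    exact C.X.presheaf.germ_stalkSpecializes_apply _ _ _

/-- The degree `deg_P x = -[k(P) : k] * ord_P x` of a rational function `x` at a closed point `P`,
with the convention `deg_P 0 = -∞`. -/
def ClosedPoint.deg (P : C.ClosedPoint) (x : C.K) : WithBot ℤ :=
  open scoped Classical in
  if x = 0 then ⊥ else ((-((P.degree : ℤ) * Scheme.ord x P.1) : ℤ) : WithBot ℤ)

variable (C)

/-- Repartitions (pre-adeles): families of rational functions, indexed by the closed points `P`,
almost all of whose members lie in the respective local ring `R_P`. -/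
def repartitions : Submodule k (C.ClosedPoint → C.K) where
  carrier := {r | {P | r P ∉ P.localRing}.Finite}
  zero_mem' := by
    simp only [Set.mem_ofPred_eq, Pi.zero_apply]
    convert Set.finite_empty
    simp [zero_mem]
  add_mem' {a b} ha hb := by
    refine (Set.Finite.union ha hb).subset fun P hP => ?_
    by_contra h
    simp only [Set.mem_union, Set.mem_ofPred_eq, not_or, not_not] at h
    exact hP (add_mem h.1 h.2)
  smul_mem' c a ha := by
    refine Set.Finite.subset ha fun _ hP h => hP (Subalgebra.smul_mem _ h c)

/-- Families of rational functions all of whose members lie in the respective local ring. -/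
def integralRepartitions : Submodule k (C.ClosedPoint → C.K) where
  carrier := {r | ∀ P, r P ∈ P.localRing}
  zero_mem' _ := zero_mem _
  add_mem' ha hb P := add_mem (ha P) (hb P)
  smul_mem' c _ ha P := Subalgebra.smul_mem _ (ha P) c

/-- The constant families, i.e. the function field embedded diagonally. -/
def principalRepartitions : Submodule k (C.ClosedPoint → C.K) :=
  LinearMap.range (LinearMap.pi fun _ : C.ClosedPoint => (LinearMap.id : C.K →ₗ[k] C.K))

/-- The cohomology group `H¹(C, 𝒪_C)`. The flasque resolution
`0 → 𝒪_C → K → ⨁_P K / R_P → 0` of the structure sheaf computes it as the cokernel of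
`K → ⨁_P K / R_P`, that is, as the space of repartitions modulo the integral and the principal
ones. -/
abbrev H1 : Type u :=
  C.repartitions ⧸
    (C.integralRepartitions ⊔ C.principalRepartitions).submoduleOf C.repartitions

/-- The genus `g = dim_k H¹(C, 𝒪_C)`. -/
def genus : ℕ := Module.finrank k C.H1

/-- The coordinate ring `k[C°]` of the complement `C°` of a finite set `S` of closed points: the
ring of all rational functions that are regular away from `S`, `⋂_{P ∉ S} R_P`. -/
def coordRing (S : Finset C.ClosedPoint) : Subalgebra k C.K :=
  ⨅ P : {P : C.ClosedPoint // P ∉ S}, P.1.localRing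

variable {C} {S : Finset C.ClosedPoint} {n : ℕ}

/-- The degree `deg v = log_q |v|` of a vector over `R = k[C°]`: as the norm of `R` is the product
of the norms `|·|_P = q ^ deg_P` over the points `P` at infinity and `|v| = ∏_P max_i |v_i|_P`, it
is the sum over the points `P` at infinity of the maximum of the `deg_P v_i`. -/
def vecDeg (v : Fin n → C.coordRing S) : WithBot ℤ :=
  ∑ P ∈ S, Finset.univ.sup fun i => P.deg (v i : C.K)

/-- The degree `deg f = log_q |f|` of a form over `R = k[C°]`: the sum over the points `P` at
infinity of the maximal degree `deg_P` of a coefficient of `f`. -/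
def formDeg (f : MvPolynomial (Fin n) (C.coordRing S)) : WithBot ℤ :=
  ∑ P ∈ S, f.support.sup fun d => P.deg ((f.coeff d : C.coordRing S) : C.K)

end

end NiceCurve

/-! An isotropic vector of least degree satisfies the bound. The argument is a Cassels-type descent
by reflections, with Riemann's inequality in the role of the geometry of numbers. A least degree
exists because degrees of nonzero vectors over R are nonnegative, by the product formula
(`sum_deg_mul_ord_nonpos`).

Let a be isotropic with entries of order at least μ_P at P ∈ S, let φ_P bound the orders of the
coefficients of f from below, and let B be the polar form. For f(x) ≠ 0 the vector f(x)a − B(a,x)x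
is nonzero and isotropic, and it does not change when a multiple of a is added to x
(`quadReflect_add_mul`). So if x differs from some multiple of a by a vector of order at least β_P,
the new vector has order at least φ_P + μ_P + 2β_P, which exceeds μ_P once 2β_P > −φ_P. It remains
to find a nonzero x ∈ Rⁿ that lies this close to the line Ka at every P ∈ S and is itself shorter
than a, in case f(x) = 0. A dimension count provides x exactly when a violates the bound
(`exists_approx_multiple`, `exists_shorter_isotropic`). Nothing is divided by 2, so the
characteristic is arbitrary.

The count rests on ℓ(D) ≥ deg D + 1 − g for D ≥ 0 (`degree_add_one_le`), proved with repartitions.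
Weak approximation gives deg (x)_∞ = [K : k(x)] (`degree_poles`), so principal divisors have degree
0; this bounds deg D − ℓ(D) and makes H¹ finite-dimensional. `IsComplete` isolates what this needs
from the curve: étale coordinates make the local rings discrete valuation rings and K finite over
k(x), separatedness distinguishes the local rings inside K, and properness makes the global
functions finite over k. -/

/-! ### Relative dimension of subspaces -/

namespace Submodule

variable {k M M' : Type*} [Field k] [AddCommGroup M] [Module k M] [AddCommGroup M'] [Module k M']

/-- The dimension of `B / (A ∩ B)`, as an extended natural number. -/
noncomputable def relDim (A B : Submodule k M) : ℕ∞ := Module.length k (B.map A.mkQ)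

theorem relDim_comap_left (f : M →ₗ[k] M') (A : Submodule k M') (B : Submodule k M) :
    relDim (A.comap f) B = relDim A (B.map f) := by
  let g : (M ⧸ A.comap f) →ₗ[k] M' ⧸ A := (A.comap f).mapQ A f le_rfl
  have hg : Function.Injective g := by
    rw [← LinearMap.ker_eq_bot, ker_mapQ, eq_bot_iff]
    rintro _ ⟨x, hx, rfl⟩
    simpa using hx
  have h : (B.map (A.comap f).mkQ).map g = (B.map f).map A.mkQ := by
    rw [← map_comp, ← map_comp]
    rfl
  rw [relDim, relDim, ← h]
  exact (equivMapOfInjective g hg _).length_eq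

theorem relDim_map_of_injective (f : M →ₗ[k] M') (hf : Function.Injective f)
    (A B : Submodule k M) : relDim (A.map f) (B.map f) = relDim A B := by
  rw [← relDim_comap_left, comap_map_eq_of_injective hf]

theorem relDim_mono_right (A : Submodule k M) {B C : Submodule k M} (h : B ≤ C) :
    relDim A B ≤ relDim A C :=
  Module.length_le_of_injective (inclusion (map_mono h)) (inclusion_injective _)

theorem relDim_inf_left (A B : Submodule k M) : relDim (A ⊓ B) B = relDim A B := by
  have h1 : (A ⊓ B).comap B.subtype = A.comap B.subtype := by
    ext x; simp
  have h2 : (⊤ : Submodule k B).map B.subtype = B := by simp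
  calc relDim (A ⊓ B) B = relDim (A ⊓ B) ((⊤ : Submodule k B).map B.subtype) := by rw [h2]
    _ = relDim A ((⊤ : Submodule k B).map B.subtype) := by
      rw [← relDim_comap_left, ← relDim_comap_left, h1]
    _ = relDim A B := by rw [h2]

theorem relDim_sup_right (A B : Submodule k M) : relDim A (A ⊔ B) = relDim A B := by
  have h : A.map A.mkQ = ⊥ := by rw [← LinearMap.le_ker_iff_map, ker_mkQ]
  rw [relDim, relDim, map_sup, h, bot_sup_eq]

theorem relDim_top (A : Submodule k M) : relDim A ⊤ = Module.length k (M ⧸ A) := by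
  rw [relDim, map_top, range_mkQ, Module.length_top]

theorem relDim_bot (B : Submodule k M) : relDim ⊥ B = Module.length k B := by
  rw [relDim]
  exact (equivMapOfInjective _ (by rw [← LinearMap.ker_eq_bot, ker_mkQ]) B).length_eq.symm

theorem relDim_eq_zero {A B : Submodule k M} : relDim A B = 0 ↔ B ≤ A := by
  rw [relDim, Module.length_eq_zero_iff, subsingleton_iff_eq_bot, ← LinearMap.le_ker_iff_map, ker_mkQ]

theorem relDim_self (A : Submodule k M) : relDim A A = 0 := relDim_eq_zero.2 le_rfl

theorem relDim_add {A B C : Submodule k M} (hAB : A ≤ B) (hBC : B ≤ C) :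
    relDim A B + relDim B C = relDim A C := by
  let f : B.map A.mkQ →ₗ[k] C.map A.mkQ := inclusion (map_mono hBC)
  let q : (M ⧸ A) →ₗ[k] M ⧸ B := A.mapQ B LinearMap.id hAB
  have hq : (C.map A.mkQ).map q = C.map B.mkQ := by
    rw [← map_comp]; rfl
  let g : C.map A.mkQ →ₗ[k] C.map B.mkQ :=
    q.restrict fun x hx => hq ▸ mem_map_of_mem hx
  refine (Module.length_eq_add_of_exact f g (inclusion_injective _) ?_ ?_).symm
  · rintro ⟨y, hy⟩
    obtain ⟨x, hx, rfl⟩ := hq.symm ▸ hy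
    exact ⟨⟨x, hx⟩, rfl⟩
  · rintro ⟨_, x, hx, rfl⟩
    constructor
    · intro h
      have : B.mkQ x = 0 := congrArg Subtype.val h
      have hxB : x ∈ B := by simpa using this
      exact ⟨⟨A.mkQ x, x, hxB, rfl⟩, rfl⟩
    · rintro ⟨⟨_, y, hy, rfl⟩, h⟩
      have h' : A.mkQ y = A.mkQ x := congrArg Subtype.val h
      apply Subtype.ext
      change q (A.mkQ x) = 0
      rw [← h']
      change B.mkQ y = 0
      simpa using hy

/-- The modular law A ⊔ (B ⊓ N) = (A ⊔ N) ⊓ B gives an intermediate space that cuts A ≤ B into two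
steps, one seen inside N and one seen modulo N. -/
theorem relDim_inf_add_sup {A B : Submodule k M} (h : A ≤ B) (N : Submodule k M) :
    relDim (A ⊓ N) (B ⊓ N) + relDim (A ⊔ N) (B ⊔ N) = relDim A B := by
  have h1 : relDim (A ⊓ N) (B ⊓ N) = relDim A (A ⊔ B ⊓ N) := by
    rw [relDim_sup_right, ← relDim_inf_left A, ← inf_assoc, inf_eq_left.2 h]
  have h2 : relDim (A ⊔ N) (B ⊔ N) = relDim (A ⊔ B ⊓ N) B := by
    have e1 : B ⊔ N = (A ⊔ N) ⊔ B := by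
      rw [sup_right_comm, sup_eq_right.2 h]
    have e2 : A ⊔ B ⊓ N = (A ⊔ N) ⊓ B := by
      rw [sup_inf_assoc_of_le N h, inf_comm]
    rw [e1, relDim_sup_right, e2, relDim_inf_left]
  rw [h1, h2, relDim_add le_sup_left (sup_le h inf_le_left)]

theorem card_le_relDim {ι : Type*} [Fintype ι] {A B : Submodule k M} (b : ι → M)
    (hb : ∀ i, b i ∈ B) (hli : LinearIndependent k fun i => A.mkQ (b i)) :
    (Fintype.card ι : ℕ∞) ≤ relDim A B := by
  let b' : ι → B.map A.mkQ := fun i => ⟨A.mkQ (b i), mem_map_of_mem (hb i)⟩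
  have hb' : LinearIndependent k b' :=
    LinearIndependent.of_comp (B.map A.mkQ).subtype hli
  have := Module.length_le_of_injective (Finsupp.linearCombination k b') hb'
  simpa [Module.length_finsupp, relDim] using this

theorem exists_linearIndependent_mkQ {A B : Submodule k M} {N : ℕ} (h : (N : ℕ∞) ≤ relDim A B) :
    ∃ b : Fin N → M, (∀ i, b i ∈ B) ∧ LinearIndependent k fun i => A.mkQ (b i) := by
  rw [relDim, Module.length_eq_rank, Cardinal.natCast_le_toENat] at h
  obtain ⟨b, hb⟩ := exists_linearIndependent_of_le_rank h
  choose c hc hcb using fun i => (b i).2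
  refine ⟨c, hc, ?_⟩
  have e : (fun i => A.mkQ (c i)) = (B.map A.mkQ).subtype ∘ b := funext hcb
  rw [e]
  exact hb.map' _ (ker_subtype _)

end Submodule

/-! ### Places of a field over a field of constants -/

/-- The elements of value at least `m`. -/
def AddValuation.leSubmodule {k K : Type*} [Field k] [Field K] [Algebra k K]
    (v : AddValuation K (WithTop ℤ)) (hv : ∀ c : k, 0 ≤ v (algebraMap k K c)) (m : ℤ) :
    Submodule k K where
  carrier := {x | (m : WithTop ℤ) ≤ v x}
  zero_mem' := by simp
  add_mem' ha hb := v.map_le_add ha hb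
  smul_mem' c x hx := by
    simp only [Set.mem_ofPred_eq, Algebra.smul_def, v.map_mul] at hx ⊢
    simpa using add_le_add (hv c) hx

/-- A discrete place of `K` over `k` with a residue field of finite degree over `k`. -/
structure Place (k K : Type*) [Field k] [Field K] [Algebra k K] where
  /-- the normalized valuation -/
  ord : AddValuation K (WithTop ℤ)
  /-- the degree of the residue field -/
  deg : ℕ
  ord_algebraMap_nonneg : ∀ c : k, 0 ≤ ord (algebraMap k K c)
  exists_uniformizer : ∃ t, ord t = 1
  relDim_residue : Submodule.relDim (ord.leSubmodule ord_algebraMap_nonneg 1)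
    (ord.leSubmodule ord_algebraMap_nonneg 0) = deg

namespace Place

variable {k K : Type*} [Field k] [Field K] [Algebra k K] (p : Place k K)

/-- The elements of order at least `m`. -/
def box (m : ℤ) : Submodule k K := p.ord.leSubmodule p.ord_algebraMap_nonneg m

variable {p}

theorem mem_box {m : ℤ} {x : K} : x ∈ p.box m ↔ (m : WithTop ℤ) ≤ p.ord x := Iff.rfl

theorem box_anti {m n : ℤ} (h : m ≤ n) : p.box n ≤ p.box m := fun _ hx =>
  (WithTop.coe_le_coe.2 h).trans hx

theorem exists_ord_eq {x : K} (hx : x ≠ 0) : ∃ m : ℤ, p.ord x = m :=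
  ⟨_, (WithTop.coe_untop _ (p.ord.ne_top_iff.2 hx)).symm⟩

theorem ord_inv {x : K} {m : ℤ} (h : p.ord x = m) : p.ord x⁻¹ = (-m : ℤ) := by
  have hx : x ≠ 0 := by
    rintro rfl
    simp at h
  obtain ⟨l, hl⟩ := exists_ord_eq (p := p) (inv_ne_zero hx)
  have := p.ord.map_mul x x⁻¹
  rw [mul_inv_cancel₀ hx, p.ord.map_one, h, hl] at this
  have h2 : (0 : ℤ) = m + l := by exact_mod_cast this
  rw [hl]
  congr 1
  omega

theorem ord_pow {x : K} {m : ℤ} (h : p.ord x = m) (n : ℕ) : p.ord (x ^ n) = ((n * m : ℤ)) := by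
  rw [p.ord.map_pow, h, ← WithTop.coe_nsmul]
  simp

theorem exists_ord_eq_int (p : Place k K) (m : ℤ) : ∃ t, t ≠ 0 ∧ p.ord t = m := by
  obtain ⟨t, ht⟩ := p.exists_uniformizer
  have ht' : p.ord t = ((1 : ℤ) : WithTop ℤ) := ht
  have : ∃ s, p.ord s = m := by
    obtain ⟨n, rfl | rfl⟩ := Int.eq_nat_or_neg m
    · exact ⟨t ^ n, by simpa using ord_pow ht' n⟩
    · exact ⟨(t ^ n)⁻¹, by simpa using ord_inv (ord_pow ht' n)⟩
  obtain ⟨s, hs⟩ := this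
  refine ⟨s, ?_, hs⟩
  rintro rfl
  simp at hs

theorem ord_algebraMap (p : Place k K) {c : k} (hc : c ≠ 0) : p.ord (algebraMap k K c) = 0 := by
  have hc' : algebraMap k K c ≠ 0 := by simpa
  obtain ⟨m, hm⟩ := exists_ord_eq (p := p) hc'
  have h1 := p.ord_algebraMap_nonneg c
  have h2 := p.ord_algebraMap_nonneg c⁻¹
  rw [map_inv₀, ord_inv hm] at h2
  rw [hm] at h1 ⊢
  norm_cast at *
  omega

theorem map_box {t : K} {j : ℤ} (ht : p.ord t = j) (m : ℤ) :
    (p.box m).map (LinearMap.mulLeft k t) = p.box (m + j) := by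
  have ht0 : t ≠ 0 := by
    rintro rfl
    simp at ht
  ext x
  simp only [Submodule.mem_map, LinearMap.mulLeft_apply, mem_box]
  constructor
  · rintro ⟨y, hy, rfl⟩
    rw [p.ord.map_mul, ht, add_comm, WithTop.coe_add]
    gcongr
  · intro hx
    refine ⟨t⁻¹ * x, ?_, mul_inv_cancel_left₀ ht0 x⟩
    rw [p.ord.map_mul, ord_inv ht]
    calc (m : WithTop ℤ) = ((-j : ℤ) : WithTop ℤ) + ((m + j : ℤ) : WithTop ℤ) := by
          rw [← WithTop.coe_add]; congr 1; ring
      _ ≤ _ := by gcongr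

/-- Multiplication by an element of order m + j carries the residue field onto each successive
quotient. -/
theorem relDim_box (m : ℤ) (j : ℕ) :
    Submodule.relDim (p.box (m + j)) (p.box m) = ((j * p.deg : ℕ) : ℕ∞) := by
  induction j with
  | zero => simp [Submodule.relDim_self]
  | succ j ih =>
    have h1 : Submodule.relDim (p.box (m + (j + 1 : ℕ))) (p.box (m + j)) = p.deg := by
      obtain ⟨t, ht0, ht⟩ := p.exists_ord_eq_int (m + j)
      have e0 := map_box ht 0
      have e1 := map_box ht 1
      rw [zero_add] at e0
      rw [show (m + (j + 1 : ℕ) : ℤ) = 1 + (m + j) by push_cast; ring, ← e0, ← e1,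
        Submodule.relDim_map_of_injective _ (mul_right_injective₀ ht0)]
      exact p.relDim_residue
    rw [← Submodule.relDim_add (box_anti (by omega)) (box_anti (show m ≤ m + j by omega)), h1, ih]
    push_cast
    ring

theorem deg_pos (p : Place k K) : 0 < p.deg := by
  by_contra h
  have h0 : p.deg = 0 := by omega
  have := p.relDim_residue
  rw [h0, Nat.cast_zero, Submodule.relDim_eq_zero] at this
  have h1 : (1 : K) ∈ p.box 0 := by simp [mem_box]
  have h2 : (1 : K) ∈ p.box 1 := this h1
  rw [mem_box, p.ord.map_one] at h2
  norm_cast at h2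

end Place

/-! ### Divisors and repartitions -/

namespace Place

variable {k K ι : Type*} [Field k] [Field K] [Algebra k K] (p : ι → Place k K)

/-- The degree of a divisor. -/
noncomputable def degree : (ι →₀ ℤ) →+ ℤ :=
  Finsupp.liftAddHom fun P => AddMonoidHom.mulRight ((p P).deg : ℤ)

theorem degree_single (P : ι) (n : ℤ) : degree p (Finsupp.single P n) = n * (p P).deg := by
  simp [degree]

theorem degree_eq_sum {D : ι →₀ ℤ} {s : Finset ι} (hs : D.support ⊆ s) :
    degree p D = ∑ P ∈ s, D P * (p P).deg := by
  simp only [degree, Finsupp.liftAddHom_apply, AddMonoidHom.coe_mulRight]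
  exact Finsupp.sum_of_support_subset _ hs _ (by simp)

theorem degree_nonneg {D : ι →₀ ℤ} (hD : 0 ≤ D) : 0 ≤ degree p D := by
  rw [degree_eq_sum p subset_rfl]
  exact Finset.sum_nonneg fun P _ => mul_nonneg (hD P) (by positivity)

/-- The families of elements with poles bounded by the divisor `D`. -/
def adele (D : ι →₀ ℤ) : Submodule k (ι → K) :=
  Submodule.pi Set.univ fun P => (p P).box (-D P)

variable {p}

theorem mem_adele {D : ι →₀ ℤ} {r : ι → K} :
    r ∈ adele p D ↔ ∀ P, ((-D P : ℤ) : WithTop ℤ) ≤ (p P).ord (r P) := by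
  simp [adele, Submodule.mem_pi, mem_box]

theorem adele_mono {D E : ι →₀ ℤ} (h : D ≤ E) : adele p D ≤ adele p E := by
  intro r hr
  rw [mem_adele] at hr ⊢
  exact fun P => le_trans (WithTop.coe_le_coe.2 (neg_le_neg (h P))) (hr P)

variable (p) in
theorem relDim_adele_single (D : ι →₀ ℤ) (P : ι) (j : ℕ) :
    Submodule.relDim (adele p D) (adele p (D + Finsupp.single P (j : ℤ))) =
      ((j * (p P).deg : ℕ) : ℕ∞) := by
  classical
  set D' := D + Finsupp.single P (j : ℤ) with hD'
  have hle : D ≤ D' := by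
    rw [hD']
    exact le_add_of_nonneg_right (Finsupp.single_nonneg.2 (by positivity))
  have hP : D' P = D P + j := by simp [hD']
  let π : (ι → K) →ₗ[k] K := LinearMap.proj P
  have h1 : adele p D = ((p P).box (-D P)).comap π ⊓ adele p D' := by
    ext r
    simp only [Submodule.mem_inf, Submodule.mem_comap, mem_box, mem_adele, π,
      LinearMap.coe_proj, Function.eval]
    constructor
    · exact fun h => ⟨h P, mem_adele.1 (adele_mono hle (mem_adele.2 h))⟩
    · rintro ⟨h, h'⟩ Q
      by_cases hQ : Q = P
      · subst hQ; exact h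
      · have := h' Q
        rwa [hD', Finsupp.add_apply, Finsupp.single_eq_of_ne hQ, add_zero] at this
  have h2 : (adele p D').map π = (p P).box (-D' P) := by
    ext x
    constructor
    · rintro ⟨r, hr, rfl⟩
      exact mem_adele.1 hr P
    · intro hx
      refine ⟨Pi.single P x, mem_adele.2 fun Q => ?_, by simp [π]⟩
      by_cases hQ : Q = P
      · subst hQ; rwa [Pi.single_eq_same]
      · simp [Pi.single_eq_of_ne hQ]
  rw [h1, Submodule.relDim_inf_left, Submodule.relDim_comap_left, h2, hP,
    show -D P = -(D P + j) + j by ring, relDim_box]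

theorem relDim_adele_add (D : ι →₀ ℤ) (E : ι →₀ ℕ) :
    Submodule.relDim (adele p D) (adele p (D + E.mapRange (Nat.cast : ℕ → ℤ) (by simp))) =
      ((degree p (E.mapRange (Nat.cast : ℕ → ℤ) (by simp))).toNat : ℕ∞) := by
  induction E using Finsupp.induction_linear generalizing D with
  | zero => simp [Submodule.relDim_self]
  | add E F hE hF =>
    have e : (E + F).mapRange (Nat.cast : ℕ → ℤ) (by simp) =
        E.mapRange (Nat.cast : ℕ → ℤ) (by simp) + F.mapRange (Nat.cast : ℕ → ℤ) (by simp) := by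
      ext; simp
    have hpos : ∀ G : ι →₀ ℕ, 0 ≤ G.mapRange (Nat.cast : ℕ → ℤ) (by simp) := fun G P => by simp
    rw [e, ← add_assoc, ← Submodule.relDim_add (adele_mono (le_add_of_nonneg_right (hpos E)))
      (adele_mono (le_add_of_nonneg_right (hpos F))), hE, hF, map_add, Int.toNat_add
      (degree_nonneg p (hpos E)) (degree_nonneg p (hpos F))]
    push_cast
    rfl
  | single P n =>
    rw [Finsupp.mapRange_single, relDim_adele_single, degree_single]
    congr 1

theorem relDim_adele {D E : ι →₀ ℤ} (h : D ≤ E) :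
    Submodule.relDim (adele p D) (adele p E) = ((degree p E - degree p D).toNat : ℕ∞) := by
  let F : ι →₀ ℕ := (E - D).mapRange Int.toNat rfl
  have hF : F.mapRange (Nat.cast : ℕ → ℤ) (by simp) = E - D := by
    ext P
    simp only [F, Finsupp.mapRange_apply]
    exact Int.toNat_of_nonneg (by simpa using h P)
  have := relDim_adele_add (p := p) D F
  rwa [hF, add_sub_cancel, map_sub] at this

end Place

/-! ### Weak approximation -/

namespace Place

variable {k K ι : Type*} [Field k] [Field K] [Algebra k K]

/-- No valuation ring of the family contains another one. -/
def Separated (p : ι → Place k K) : Prop :=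
  ∀ P Q, P ≠ Q → ∃ x, 0 ≤ (p P).ord x ∧ (p Q).ord x < 0

variable {p : ι → Place k K}

theorem Separated.comp {κ : Type*} (h : Separated p) {f : κ → ι} (hf : Function.Injective f) :
    Separated (p ∘ f) := fun _ _ hPQ => h _ _ (hf.ne hPQ)

theorem ord_add_of_lt {q : Place k K} {x y : K} (h : q.ord x < q.ord y) :
    q.ord (x + y) = q.ord x := q.ord.map_add_eq_of_lt_left h

/-- The quotient of a separating element for (P, Q) by one for (Q, P) works. -/
theorem Separated.exists_pos_neg (h : Separated p) {P Q : ι} (hPQ : P ≠ Q) :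
    ∃ z, 0 < (p P).ord z ∧ (p Q).ord z < 0 := by
  obtain ⟨x, hx, hx'⟩ := h P Q hPQ
  obtain ⟨y, hy, hy'⟩ := h Q P hPQ.symm
  have hy0 : y ≠ 0 := by
    rintro rfl
    simp at hy'
  have hx0 : x ≠ 0 := by
    rintro rfl
    simp at hx'
  obtain ⟨a, ha⟩ := exists_ord_eq (p := p P) hx0
  obtain ⟨b, hb⟩ := exists_ord_eq (p := p Q) hx0
  obtain ⟨c, hc⟩ := exists_ord_eq (p := p P) hy0
  obtain ⟨e, he⟩ := exists_ord_eq (p := p Q) hy0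
  refine ⟨x * y⁻¹, ?_, ?_⟩
  · rw [(p P).ord.map_mul, ord_inv hc, ha]
    rw [ha] at hx
    rw [hc] at hy'
    norm_cast at *
    omega
  · rw [(p Q).ord.map_mul, ord_inv he, hb]
    rw [hb] at hx'
    rw [he] at hy
    norm_cast at *
    omega

theorem ord_pow_of_nonneg {q : Place k K} {y : K} (h : 0 ≤ q.ord y) (r : ℕ) :
    0 ≤ q.ord (y ^ r) := by
  rw [q.ord.map_pow]
  exact nsmul_nonneg h r

theorem ord_pow_of_pos {q : Place k K} {y : K} (h : 0 < q.ord y) (r : ℕ) :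
    ((r : ℤ) : WithTop ℤ) ≤ q.ord (y ^ r) := by
  by_cases hy : y = 0
  · subst hy
    rcases r with _ | r <;> simp
  · obtain ⟨m, hm⟩ := exists_ord_eq (p := q) hy
    rw [ord_pow hm]
    rw [hm] at h
    norm_cast at *
    nlinarith

/-- To gain a pole at a new point Q, add a power of some y with a zero at P and a pole at Q. The
exponent exceeds all pole orders of z on T, so no cancellation occurs where y has a pole. -/
theorem Separated.exists_pos_forall_neg (h : Separated p) (P : ι) (T : Finset ι) (hP : P ∉ T) :
    ∃ z, 0 < (p P).ord z ∧ ∀ Q ∈ T, (p Q).ord z < 0 := by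
  classical
  induction T using Finset.induction_on with
  | empty => exact ⟨0, by simp⟩
  | insert Q T hQ ih =>
    obtain ⟨hPQ, hPT⟩ : P ≠ Q ∧ P ∉ T := by simpa using hP
    obtain ⟨z, hz, hzT⟩ := ih hPT
    by_cases hzQ : (p Q).ord z < 0
    · exact ⟨z, hz, by simpa using ⟨hzQ, hzT⟩⟩
    obtain ⟨y, hy, hyQ⟩ := h.exists_pos_neg hPQ
    have hy0 : y ≠ 0 := by
      rintro rfl
      simp at hyQ
    obtain ⟨r, hr0, hr⟩ : ∃ r : ℕ, 0 < r ∧ ∀ Q' ∈ T, ((-r : ℤ) : WithTop ℤ) < (p Q').ord z := by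
      have : ∀ Q', ∃ r : ℕ, 0 < r ∧ ((-r : ℤ) : WithTop ℤ) < (p Q').ord z := by
        intro Q'
        by_cases hz0 : z = 0
        · subst hz0; exact ⟨1, by simp, by simp [lt_top_iff_ne_top]⟩
        obtain ⟨m, hm⟩ := exists_ord_eq (p := p Q') hz0
        refine ⟨(-m).toNat + 1, by omega, ?_⟩
        rw [hm]
        norm_cast
        omega
      choose r hr0 hr using this
      refine ⟨1 + T.sup r, by omega, fun Q' hQ' => lt_of_le_of_lt ?_ (hr Q')⟩
      have := Finset.le_sup (f := r) hQ'
      norm_cast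
      omega
    have hneg : ∀ Q', (p Q').ord y < 0 → (p Q').ord (y ^ r) ≤ ((-r : ℤ) : WithTop ℤ) := by
      intro Q' hQ'
      obtain ⟨m, hm⟩ := exists_ord_eq (p := p Q') hy0
      rw [ord_pow hm]
      rw [hm] at hQ'
      norm_cast at *
      nlinarith
    refine ⟨z + y ^ r, (p P).ord.map_lt_add hz ?_, ?_⟩
    · exact lt_of_lt_of_le (by exact_mod_cast hr0) (ord_pow_of_pos hy r)
    · intro Q' hQ'
      obtain rfl | hQ' := Finset.mem_insert.1 hQ'
      · have h1 : (p Q').ord (y ^ r) < 0 :=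
          lt_of_le_of_lt (hneg Q' hyQ) (by norm_cast; omega)
        rw [add_comm, ord_add_of_lt (h1.trans_le (not_lt.1 hzQ))]
        exact h1
      · by_cases hyQ' : (p Q').ord y < 0
        · have h1 : (p Q').ord (y ^ r) < 0 :=
            lt_of_le_of_lt (hneg Q' hyQ') (by norm_cast; omega)
          rw [add_comm, ord_add_of_lt ((hneg Q' hyQ').trans_lt (hr Q' hQ'))]
          exact h1
        · rw [ord_add_of_lt ((hzT Q' hQ').trans_le (ord_pow_of_nonneg (not_lt.1 hyQ') r))]
          exact hzT Q' hQ'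

theorem Separated.exists_approx_one (h : Separated p) (P : ι) (T : Finset ι) (hP : P ∉ T) (m : ℕ) :
    ∃ w, ((m : ℤ) : WithTop ℤ) ≤ (p P).ord (w - 1) ∧
      ∀ Q ∈ T, ((m : ℤ) : WithTop ℤ) ≤ (p Q).ord w := by
  obtain ⟨z, hz, hzT⟩ := h.exists_pos_forall_neg P T hP
  -- The inverse of u is close to 1 at the zero P of z and close to 0 at the poles in T. The
  -- exponent is m + 1 so that the power vanishes at P even for m = 0.
  set u := 1 + z ^ (m + 1) with hu
  have hzm := ord_pow_of_pos hz (m + 1)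
  have hzm0 : (p P).ord 1 < (p P).ord (z ^ (m + 1)) := by
    rw [(p P).ord.map_one]
    refine lt_of_lt_of_le ?_ hzm
    norm_cast
    omega
  have huP : (p P).ord u = (0 : ℤ) := by
    rw [hu, ord_add_of_lt hzm0, (p P).ord.map_one]
    rfl
  have hu0 : u ≠ 0 := by
    intro h0
    rw [h0] at huP
    simp at huP
  refine ⟨u⁻¹, ?_, fun Q hQ => ?_⟩
  · have e : u⁻¹ - 1 = -(z ^ (m + 1) * u⁻¹) := by
      field_simp
      rw [hu]
      ring
    rw [e, (p P).ord.map_neg, (p P).ord.map_mul, ord_inv huP]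
    refine le_trans ?_ (add_le_add hzm le_rfl)
    norm_cast
    omega
  · have hzQ := hzT Q hQ
    have hz0 : z ≠ 0 := by
      rintro rfl
      simp at hzQ
    obtain ⟨a, ha⟩ := exists_ord_eq (p := p Q) hz0
    rw [ha] at hzQ
    have ha0 : a < 0 := by exact_mod_cast hzQ
    have hzp := ord_pow ha (m + 1)
    have hneg : ((m + 1 : ℕ) : ℤ) * a ≤ -(m + 1 : ℕ) := by nlinarith [Int.natCast_nonneg (m + 1)]
    have huQ : (p Q).ord u = ((m + 1 : ℕ) * a : ℤ) := by
      rw [hu, add_comm, ord_add_of_lt, hzp]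
      rw [hzp, (p Q).ord.map_one]
      norm_cast
      push_cast at hneg ⊢
      omega
    rw [ord_inv huQ]
    norm_cast
    push_cast at hneg ⊢
    omega

theorem Separated.exists_approx [Fintype ι] (h : Separated p) (a : ι → K) (m : ι → ℤ) :
    ∃ x, ∀ P, (m P : WithTop ℤ) ≤ (p P).ord (a P - x) := by
  classical
  have key : ∀ P, ∃ y, ∀ Q, (m Q : WithTop ℤ) ≤ (p Q).ord ((if Q = P then a P else 0) - y) := by
    intro P
    by_cases ha : a P = 0
    · exact ⟨0, fun Q => by simp [ha]⟩
    choose c hc using fun Q => exists_ord_eq (p := p Q) ha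
    -- The precision dominates every m Q − ord_Q (a P), which makes up for the later multiplication
    -- by a P.
    obtain ⟨w, hw, hw'⟩ := h.exists_approx_one P (Finset.univ.erase P) (by simp)
      (∑ Q, (m Q - c Q).toNat)
    have hm : ∀ Q, m Q - c Q ≤ ((∑ Q, (m Q - c Q).toNat : ℕ) : ℤ) := by
      intro Q
      have := Finset.single_le_sum (f := fun Q => (m Q - c Q).toNat) (fun _ _ => Nat.zero_le _)
        (Finset.mem_univ Q)
      omega
    refine ⟨a P * w, fun Q => ?_⟩
    have aux : ∀ s, ((∑ Q, (m Q - c Q).toNat : ℕ) : ℤ) ≤ (p Q).ord s →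
        (m Q : WithTop ℤ) ≤ (p Q).ord (a P * s) := by
      intro s hs
      rw [(p Q).ord.map_mul, hc Q]
      refine le_trans ?_ (add_le_add le_rfl hs)
      have := hm Q
      norm_cast
      push_cast at this ⊢
      omega
    by_cases hQ : Q = P
    · subst hQ
      rw [if_pos rfl, show a Q - a Q * w = -(a Q * (w - 1)) by ring, (p Q).ord.map_neg]
      exact aux _ hw
    · rw [if_neg hQ, zero_sub, (p Q).ord.map_neg]
      exact aux _ (hw' Q (by simp [hQ]))
  choose y hy using key
  refine ⟨∑ P, y P, fun Q => ?_⟩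
  have e : a Q - ∑ P, y P = ∑ P, ((if Q = P then a P else 0) - y P) := by
    rw [Finset.sum_sub_distrib]
    simp
  rw [e]
  exact (p Q).ord.map_le_sum fun P _ => hy P Q

/-! ### Spaces of elements with bounded poles -/

variable (k K) in
/-- The diagonal embedding. -/
def diag (ι : Type*) : K →ₗ[k] (ι → K) := LinearMap.pi fun _ => LinearMap.id

@[simp] theorem diag_apply (x : K) (P : ι) : diag k K ι x P = x := rfl

variable (p) in
/-- The elements of the field with poles bounded by the divisor `D`. -/
def bounded (D : ι →₀ ℤ) : Submodule k K := (adele p D).comap (diag k K ι)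

theorem mem_bounded {D : ι →₀ ℤ} {x : K} :
    x ∈ bounded p D ↔ ∀ P, ((-D P : ℤ) : WithTop ℤ) ≤ (p P).ord x := by
  rw [bounded, Submodule.mem_comap, mem_adele]
  rfl

theorem bounded_mono {D E : ι →₀ ℤ} (h : D ≤ E) : bounded p D ≤ bounded p E :=
  Submodule.comap_mono (adele_mono h)

theorem diag_injective [Nonempty ι] : Function.Injective (diag k K ι) := fun _ _ h =>
  congrFun h (Classical.arbitrary ι)

/-- Riemann–Roch in difference form: `relDim_inf_add_sup` with N the diagonal copy of K. The second
summand is the drop of dim H¹ from D to E. -/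
theorem relDim_bounded_add [Nonempty ι] {D E : ι →₀ ℤ} (h : D ≤ E) :
    Submodule.relDim (bounded p D) (bounded p E) +
      Submodule.relDim (adele p D ⊔ LinearMap.range (diag k K ι))
        (adele p E ⊔ LinearMap.range (diag k K ι)) =
      ((degree p E - degree p D).toNat : ℕ∞) := by
  have e : ∀ D : ι →₀ ℤ, adele p D ⊓ LinearMap.range (diag k K ι) =
      (bounded p D).map (diag k K ι) := fun D => by
    rw [bounded, Submodule.map_comap_eq, inf_comm]
  rw [← relDim_adele h, ← Submodule.relDim_inf_add_sup (adele_mono h)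
    (LinearMap.range (diag k K ι)), e, e, Submodule.relDim_map_of_injective _ diag_injective]

theorem relDim_bounded_le [Nonempty ι] {D E : ι →₀ ℤ} (h : D ≤ E) :
    Submodule.relDim (bounded p D) (bounded p E) ≤ ((degree p E - degree p D).toNat : ℕ∞) := by
  rw [← relDim_bounded_add h]
  exact le_self_add

/-- For finitely many places weak approximation kills the H¹ term, so that `relDim_bounded_add`
computes dimensions exactly. -/
theorem Separated.adele_sup_range_diag [Fintype ι] (h : Separated p) (D : ι →₀ ℤ) :
    adele p D ⊔ LinearMap.range (diag k K ι) = ⊤ := by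
  rw [eq_top_iff]
  intro r _
  obtain ⟨x, hx⟩ := h.exists_approx r fun P => -D P
  have : r = (r - diag k K ι x) + diag k K ι x := by simp
  rw [this]
  exact Submodule.add_mem_sup (mem_adele.2 hx) ⟨x, rfl⟩

theorem Separated.relDim_bounded [Fintype ι] [Nonempty ι] (h : Separated p) {D E : ι →₀ ℤ}
    (hDE : D ≤ E) :
    Submodule.relDim (bounded p D) (bounded p E) = ((degree p E - degree p D).toNat : ℕ∞) := by
  rw [← relDim_bounded_add hDE, h.adele_sup_range_diag, h.adele_sup_range_diag,
    Submodule.relDim_self, add_zero]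

end Place

/-! ### Degrees of principal divisors -/

namespace Place

open Polynomial IntermediateField

variable {k K ι : Type*} [Field k] [Field K] [Algebra k K]

theorem ord_aeval_nonneg {q : Place k K} {y : K} (hy : 0 ≤ q.ord y) (f : k[X]) :
    0 ≤ q.ord (aeval y f) := by
  rw [aeval_eq_sum_range]
  refine q.ord.map_le_sum fun i _ => ?_
  rw [Algebra.smul_def, q.ord.map_mul]
  exact add_nonneg (q.ord_algebraMap_nonneg _) (ord_pow_of_nonneg hy i)

/-- In an algebraic equation with nonzero constant term, that term has order 0 while all others have
positive order. -/
theorem transcendental_of_ord_pos {q : Place k K} {y : K} (hy0 : y ≠ 0) (hy : 0 < q.ord y) :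
    Transcendental k y := by
  intro halg
  have hint := halg.isIntegral
  have h0 := minpoly.coeff_zero_ne_zero hint hy0
  have h1 := minpoly.aeval k y
  rw [← divX_mul_X_add (minpoly k y), map_add, map_mul, aeval_X, aeval_C] at h1
  have h2 : q.ord (algebraMap k K ((minpoly k y).coeff 0)) = 0 := ord_algebraMap q h0
  have h3 : 0 < q.ord (aeval y (minpoly k y).divX * y) := by
    rw [q.ord.map_mul]
    exact lt_of_lt_of_le hy (le_add_of_nonneg_left (ord_aeval_nonneg hy.le _))
  rw [add_comm] at h1
  have h4 := ord_add_of_lt (h2.trans_lt h3)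
  rw [h1, h2] at h4
  simp at h4

/-- The properties of the family of all places of a complete curve. -/
structure IsComplete (p : ι → Place k K) : Prop where
  separated : Separated p
  finite_poles : ∀ x, {P | ¬ 0 ≤ (p P).ord x}.Finite
  finite_const : Submodule.relDim ⊥ (bounded p 0) ≠ ⊤
  finite_adjoin : ∀ x : K, Transcendental k x → FiniteDimensional k⟮x⟯ K

namespace IsComplete

variable {p : ι → Place k K} (h : IsComplete p)

/-- The divisor of poles. -/
noncomputable def poles (x : K) : ι →₀ ℤ :=
  Finsupp.onFinset (h.finite_poles x).toFinset (fun P => max 0 (-((p P).ord x).untopD 0)) (by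
    intro P hP
    simp only [Set.Finite.mem_toFinset, Set.mem_ofPred_eq]
    contrapose! hP
    by_cases hx : x = 0
    · subst hx; simp
    · obtain ⟨m, hm⟩ := exists_ord_eq (p := p P) hx
      rw [hm] at hP ⊢
      have : 0 ≤ m := by exact_mod_cast hP
      simpa using this)

theorem poles_apply {x : K} {P : ι} {m : ℤ} (hm : (p P).ord x = m) :
    h.poles x P = max 0 (-m) := by
  simp [poles, hm]

theorem poles_nonneg (x : K) : 0 ≤ h.poles x := fun P => by simp [poles]

theorem neg_poles_le_ord (x : K) (P : ι) : ((-h.poles x P : ℤ) : WithTop ℤ) ≤ (p P).ord x := by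
  by_cases hx : x = 0
  · subst hx; simp
  · obtain ⟨m, hm⟩ := exists_ord_eq (p := p P) hx
    rw [h.poles_apply hm, hm]
    norm_cast
    omega

theorem mem_bounded_poles (x : K) : x ∈ bounded p (h.poles x) :=
  mem_bounded.2 (h.neg_poles_le_ord x)

theorem mul_mem_bounded {D E : ι →₀ ℤ} {x y : K} (hx : x ∈ bounded p D) (hy : y ∈ bounded p E) :
    x * y ∈ bounded p (D + E) := by
  rw [mem_bounded] at *
  intro P
  rw [(p P).ord.map_mul]
  refine le_trans (le_of_eq ?_) (add_le_add (hx P) (hy P))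
  rw [← WithTop.coe_add]
  congr 1
  simp only [Finsupp.add_apply]
  ring

theorem pow_mem_bounded {D : ι →₀ ℤ} {x : K} (hx : x ∈ bounded p D) (j : ℕ) :
    x ^ j ∈ bounded p (j • D) := by
  induction j with
  | zero => simp [mem_bounded]
  | succ j ih =>
    rw [pow_succ, succ_nsmul]
    exact mul_mem_bounded ih hx

/-- Modulo yM a relation over k[y] involves only the constant coefficients, so these vanish.
Cancelling y and repeating kills the coefficients degree by degree. -/
theorem _root_.linearIndependent_adjoin_of_mkQ {N : ℕ} {y : K} {M : Submodule k K} {b : Fin N → K}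
    (hy0 : y ≠ 0) (hb : LinearIndependent k fun i => (M.map (LinearMap.mulLeft k y)).mkQ (b i))
    (hM : ∀ i (g : k[X]), aeval y g * b i ∈ M) : LinearIndependent (Algebra.adjoin k {y}) b := by
  have key : ∀ j : ℕ, ∀ f : Fin N → k[X], ∑ i, aeval y (f i) * b i = 0 → ∀ i, (f i).coeff j = 0 := by
    have step : ∀ f : Fin N → k[X], ∑ i, aeval y (f i) * b i = 0 →
        (∀ i, (f i).coeff 0 = 0) ∧ ∑ i, aeval y (f i).divX * b i = 0 := by
      intro f hf
      have e : ∑ i, aeval y (f i) * b i =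
          y * (∑ i, aeval y (f i).divX * b i) + ∑ i, (f i).coeff 0 • b i := by
        rw [Finset.mul_sum, ← Finset.sum_add_distrib]
        refine Finset.sum_congr rfl fun i _ => ?_
        conv_lhs => rw [← divX_mul_X_add (f i)]
        rw [map_add, map_mul, aeval_X, aeval_C, Algebra.smul_def]
        ring
      have h0 : ∀ i, (f i).coeff 0 = 0 := by
        refine Fintype.linearIndependent_iff.1 hb _ ?_
        simp only [← map_smul, ← map_sum]
        rw [Submodule.mkQ_apply, Submodule.Quotient.mk_eq_zero]
        rw [e] at hf
        rw [← neg_eq_of_add_eq_zero_right hf]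
        exact neg_mem (Submodule.mem_map_of_mem (f := LinearMap.mulLeft k y)
          (sum_mem fun i _ => hM i _))
      refine ⟨h0, ?_⟩
      rw [e] at hf
      simpa [h0, hy0] using hf
    intro j
    induction j with
    | zero => exact fun f hf => (step f hf).1
    | succ j ih =>
      intro f hf i
      rw [← coeff_divX]
      exact ih (fun i => (f i).divX) (step f hf).2 i
  rw [Fintype.linearIndependent_iff]
  intro c hc i
  have hf : ∀ i, ∃ f : k[X], aeval y f = (c i : K) := fun i => by
    have : ∀ z ∈ Algebra.adjoin k {y}, ∃ f : k[X], aeval y f = z := fun z hz => by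
      rwa [Algebra.adjoin_singleton_eq_range_aeval] at hz
    exact this _ (c i).2
  choose f hf using hf
  have h0 : f i = 0 := by
    ext j
    refine key j f ?_ i
    simpa [hf, Subalgebra.smul_def] using hc
  apply Subtype.ext
  rw [← hf, h0]
  simp

theorem _root_.IntermediateField.adjoin_simple_inv (x : K) : k⟮x⁻¹⟯ = k⟮x⟯ := by
  apply le_antisymm
  · rw [adjoin_simple_le_iff]
    exact inv_mem (mem_adjoin_simple_self k x)
  · rw [adjoin_simple_le_iff]
    simpa using inv_mem (mem_adjoin_simple_self k x⁻¹)

/-- Let O be the ring of elements integral at the poles of x. By weak approximation O/x⁻¹O has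
dimension deg (x)_∞ over k, and lifts of a basis are independent over k[x⁻¹], hence over its
fraction field k(x). -/
theorem degree_poles_le {x : K} (hx : Transcendental k x) :
    degree p (h.poles x) ≤ Module.finrank k⟮x⟯ K := by
  classical
  have hx0 : x ≠ 0 := by
    rintro rfl
    exact hx isAlgebraic_zero
  let T := (h.poles x).support
  by_cases hT : T.Nonempty
  swap
  · have : h.poles x = 0 := by simpa [T] using hT
    rw [this, map_zero]
    positivity
  let q : T → Place k K := fun P => p P
  have : Nonempty T := hT.to_subtype
  have hq : Separated q := h.separated.comp Subtype.val_injective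
  let E : T →₀ ℤ := Finsupp.equivFunOnFinite.symm fun P => h.poles x P
  have hE0 : 0 ≤ E := fun P => h.poles_nonneg x P
  have hxE : ∀ P : T, (q P).ord x⁻¹ = E P := by
    intro P
    obtain ⟨m, hm⟩ := exists_ord_eq (p := p P) hx0
    have h1 := h.poles_apply hm
    have h2 : h.poles x P ≠ 0 := Finsupp.mem_support_iff.1 P.2
    rw [ord_inv hm]
    have : E P = h.poles x P := rfl
    rw [this, h1]
    congr 1
    omega
  have hdeg : degree q E = degree p (h.poles x) := by
    rw [degree_eq_sum p (s := T) subset_rfl, degree_eq_sum q (s := Finset.univ) (Finset.subset_univ _)]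
    exact Finset.sum_coe_sort T fun P => h.poles x P * ((p P).deg : ℤ)
  have hmap : (bounded q 0).map (LinearMap.mulLeft k x⁻¹) = bounded q (-E) := by
    ext z
    constructor
    · rintro ⟨w, hw, rfl⟩
      rw [SetLike.mem_coe, mem_bounded] at hw
      rw [mem_bounded]
      intro P
      rw [LinearMap.mulLeft_apply, (q P).ord.map_mul, hxE]
      have hw0 : 0 ≤ (q P).ord w := by simpa using hw P
      simpa using add_le_add (le_refl (E P : WithTop ℤ)) hw0
    · intro hz
      refine ⟨x * z, ?_, by simp [hx0]⟩
      rw [mem_bounded] at hz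
      rw [SetLike.mem_coe, mem_bounded]
      intro P
      have := ord_inv (hxE P)
      rw [inv_inv] at this
      rw [(q P).ord.map_mul, this]
      refine le_trans (le_of_eq ?_) (add_le_add le_rfl (hz P))
      rw [← WithTop.coe_add]
      simp
  have hrel := hq.relDim_bounded (neg_nonpos.2 hE0)
  rw [map_zero, map_neg, zero_sub, neg_neg, hdeg, ← hmap] at hrel
  obtain ⟨b, hb, hbli⟩ := Submodule.exists_linearIndependent_mkQ hrel.ge
  have hli := linearIndependent_adjoin_of_mkQ (inv_ne_zero hx0) hbli (fun i g => by
    rw [mem_bounded]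
    intro P
    rw [(q P).ord.map_mul]
    refine le_trans (by simp) (add_le_add (ord_aeval_nonneg (q := q P) ?_ g) (mem_bounded.1 (hb i) P))
    rw [hxE]
    exact_mod_cast hE0 P)
  open IntermediateField.algebraAdjoinAdjoin in
  have hli' : LinearIndependent k⟮x⁻¹⟯ b :=
    (LinearIndependent.iff_fractionRing (Algebra.adjoin k {x⁻¹}) k⟮x⁻¹⟯).1 hli
  have : FiniteDimensional k⟮x⁻¹⟯ K := by
    rw [adjoin_simple_inv]
    exact h.finite_adjoin x hx
  have := hli'.fintype_card_le_finrank
  rw [adjoin_simple_inv, Fintype.card_fin] at this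
  omega

/-- The products u_i xʲ with j ≤ l, for a basis u of K over k(x), are independent over k; C collects
the poles of the u_i. -/
theorem le_relDim_bounded_smul_poles {x : K} (hx : Transcendental k x) :
    ∃ C : ι →₀ ℤ, 0 ≤ C ∧ ∀ l : ℕ, (((l + 1) * Module.finrank k⟮x⟯ K : ℕ) : ℕ∞) ≤
      Submodule.relDim ⊥ (bounded p (C + l • h.poles x)) := by
  have := h.finite_adjoin x hx
  let u := Module.finBasis k⟮x⟯ K
  refine ⟨∑ i, h.poles (u i), Finset.sum_nonneg fun i _ => h.poles_nonneg _, fun l => ?_⟩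
  have hgen : Transcendental k (AdjoinSimple.gen k x) := by
    intro hg
    exact hx (by simpa using hg.algebraMap (A := K))
  have hpow : LinearIndependent k fun j : Fin (l + 1) => AdjoinSimple.gen k x ^ (j : ℕ) := by
    have h1 := (Polynomial.basisMonomials k).linearIndependent.map'
      (aeval (R := k) (AdjoinSimple.gen k x)).toLinearMap
      (LinearMap.ker_eq_bot.2 (transcendental_iff_injective.1 hgen))
    have h2 := h1.comp (fun j : Fin (l + 1) => (j : ℕ)) Fin.val_injective
    have e : (fun j : Fin (l + 1) => AdjoinSimple.gen k x ^ (j : ℕ)) =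
        ((aeval (R := k) (AdjoinSimple.gen k x)).toLinearMap ∘ Polynomial.basisMonomials k) ∘
          fun j : Fin (l + 1) => (j : ℕ) := by
      funext j
      simp
    rw [e]
    exact h2
  have hli := linearIndependent_smul hpow u.linearIndependent
  have hcard : Fintype.card (Fin (l + 1) × Fin (Module.finrank k⟮x⟯ K)) =
      (l + 1) * Module.finrank k⟮x⟯ K := by simp
  rw [← hcard]
  refine Submodule.card_le_relDim _ (fun i => ?_)
    (hli.map' (Submodule.mkQ ⊥) (by rw [Submodule.ker_mkQ]))
  have e : AdjoinSimple.gen k x ^ (i.1 : ℕ) • u i.2 = u i.2 * x ^ (i.1 : ℕ) := by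
    rw [IntermediateField.smul_def, smul_eq_mul, mul_comm]
    simp
  rw [e]
  refine bounded_mono ?_ (mul_mem_bounded (h.mem_bounded_poles (u i.2))
    (pow_mem_bounded (h.mem_bounded_poles x) i.1))
  refine add_le_add (Finset.single_le_sum (f := fun i => h.poles (u i))
    (fun i _ => h.poles_nonneg _) (Finset.mem_univ i.2)) ?_
  exact nsmul_le_nsmul_left (h.poles_nonneg x) (by omega)

variable [Nonempty ι]

theorem relDim_bot_bounded_le {D E : ι →₀ ℤ} (hDE : D ≤ E) :
    Submodule.relDim ⊥ (bounded p E) ≤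
      Submodule.relDim ⊥ (bounded p D) + ((degree p E - degree p D).toNat : ℕ∞) := by
  rw [← Submodule.relDim_add bot_le (bounded_mono hDE)]
  exact add_le_add le_rfl (relDim_bounded_le hDE)

theorem degree_poles {x : K} (hx : Transcendental k x) :
    degree p (h.poles x) = Module.finrank k⟮x⟯ K := by
  refine le_antisymm (h.degree_poles_le hx) ?_
  obtain ⟨C, hC, hl⟩ := h.le_relDim_bounded_smul_poles hx
  obtain ⟨c, hc⟩ := ENat.ne_top_iff_exists.1 h.finite_const
  by_contra! hlt
  set n := Module.finrank k⟮x⟯ K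
  have hB := degree_nonneg p (h.poles_nonneg x)
  have hC0 := degree_nonneg p hC
  -- With n = [K : k(x)], b = deg (x)_∞ < n and this l, the upper bound c + deg C + lb = l(b + 1) ≤
  -- ln contradicts the lower bound (l + 1)n.
  set l := c + (degree p C).toNat
  have h1 := (hl l).trans (relDim_bot_bounded_le (D := 0)
    (add_nonneg hC (nsmul_nonneg (h.poles_nonneg x) l)))
  rw [← hc, map_zero, sub_zero, map_add, map_nsmul] at h1
  norm_cast at h1
  set b := degree p (h.poles x)
  have h2 : ((l + 1) * n : ℤ) ≤ c + (degree p C + l * b) := by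
    zify at h1
    rwa [Int.toNat_of_nonneg (by positivity), nsmul_eq_mul] at h1
  have h3 : (l : ℤ) = c + degree p C := by
    simp only [l]
    push_cast
    rw [Int.toNat_of_nonneg hC0]
  nlinarith

/-- The divisor of a nonzero element. -/
noncomputable def div (x : K) : ι →₀ ℤ := h.poles x⁻¹ - h.poles x

omit [Nonempty ι] in
theorem div_apply {x : K} {P : ι} {m : ℤ} (hm : (p P).ord x = m) : h.div x P = m := by
  rw [div, Finsupp.sub_apply, h.poles_apply hm, h.poles_apply (ord_inv hm)]
  omega

/-- The pole divisors of x and x⁻¹ both have degree [K : k(x)]. An algebraic element has neither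
zeros nor poles. -/
theorem degree_div (x : K) (hx0 : x ≠ 0) : degree p (h.div x) = 0 := by
  by_cases hx : Transcendental k x
  · have hx' : Transcendental k x⁻¹ := by
      intro hinv
      exact hx (by simpa using hinv.inv)
    rw [div, map_sub, h.degree_poles hx, h.degree_poles hx', adjoin_simple_inv, sub_self]
  · have : h.div x = 0 := by
      ext P
      obtain ⟨m, hm⟩ := exists_ord_eq (p := p P) hx0
      rw [h.div_apply hm, Finsupp.zero_apply]
      by_contra hm0
      rcases lt_or_gt_of_ne hm0 with hlt | hgt
      · refine transcendental_of_ord_pos (q := p P) (inv_ne_zero hx0) ?_ (not_not.1 hx).inv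
        rw [ord_inv hm]
        norm_cast
        omega
      · refine hx (transcendental_of_ord_pos (q := p P) hx0 ?_)
        rw [hm]
        exact_mod_cast hgt
    rw [this, map_zero]

end IsComplete

end Place

/-! ### The Riemann inequality -/

namespace Place

open Polynomial IntermediateField

variable {k K ι : Type*} [Field k] [Field K] [Algebra k K]

namespace IsComplete

variable {p : ι → Place k K} (h : IsComplete p)

/-- The families of elements almost all of which are integral. -/
def allRepartitions (p : ι → Place k K) : Submodule k (ι → K) where
  carrier := {r | {P | ¬ 0 ≤ (p P).ord (r P)}.Finite}
  zero_mem' := by simp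
  add_mem' {a b} ha hb := by
    refine (Set.Finite.union ha hb).subset fun P hP => ?_
    by_contra hc
    simp only [Set.mem_union, Set.mem_ofPred_eq, not_or, not_not] at hc
    exact hP ((p P).ord.map_le_add hc.1 hc.2)
  smul_mem' c a ha := by
    refine Set.Finite.subset ha fun P hP hc => hP ?_
    rw [Pi.smul_apply, Algebra.smul_def, (p P).ord.map_mul]
    exact add_nonneg ((p P).ord_algebraMap_nonneg c) hc

theorem mem_allRepartitions {r : ι → K} :
    r ∈ allRepartitions p ↔ {P | ¬ 0 ≤ (p P).ord (r P)}.Finite := Iff.rfl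

theorem adele_le_allRepartitions (D : ι →₀ ℤ) : adele p D ≤ allRepartitions p := by
  intro r hr
  rw [mem_adele] at hr
  refine D.hasFiniteSupport.subset fun P hP => ?_
  rw [Function.mem_support]
  intro h0
  exact hP (by simpa [h0] using hr P)

include h in
theorem range_diag_le_allRepartitions :
    LinearMap.range (diag k K ι) ≤ allRepartitions p := by
  rintro _ ⟨x, rfl⟩
  exact h.finite_poles x

theorem exists_mem_adele {N : ℕ} {b : Fin N → ι → K} (hb : ∀ i, b i ∈ allRepartitions p) :
    ∃ D : ι →₀ ℤ, 0 ≤ D ∧ ∀ i, b i ∈ adele p D := by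
  classical
  have h1 : ∀ i, ∃ D : ι →₀ ℤ, 0 ≤ D ∧ b i ∈ adele p D := by
    intro i
    refine ⟨Finsupp.onFinset (mem_allRepartitions.1 (hb i)).toFinset
      (fun P => max 0 (-((p P).ord (b i P)).untopD 0)) ?_, fun P => by simp, ?_⟩
    · intro P hP
      simp only [Set.Finite.mem_toFinset, Set.mem_ofPred_eq]
      contrapose! hP
      by_cases hx : b i P = 0
      · simp [hx]
      · obtain ⟨m, hm⟩ := exists_ord_eq (p := p P) hx
        rw [hm] at hP ⊢
        have : 0 ≤ m := by exact_mod_cast hP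
        simpa using this
    · rw [mem_adele]
      intro P
      rw [Finsupp.onFinset_apply]
      by_cases hx : b i P = 0
      · simp [hx]
      · obtain ⟨m, hm⟩ := exists_ord_eq (p := p P) hx
        rw [hm]
        simp only [WithTop.untopD_coe]
        norm_cast
        omega
  choose D hD0 hD using h1
  refine ⟨∑ i, D i, Finset.sum_nonneg fun i _ => hD0 i, fun i => adele_mono ?_ (hD i)⟩
  exact Finset.single_le_sum (fun i _ => hD0 i) (Finset.mem_univ i)

variable [Nonempty ι]

omit [Nonempty ι] in
theorem relDim_bounded_sub_div {z : K} (hz : z ≠ 0) (D : ι →₀ ℤ) :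
    Submodule.relDim ⊥ (bounded p (D - h.div z)) = Submodule.relDim ⊥ (bounded p D) := by
  have hmap : (bounded p D).map (LinearMap.mulLeft k z) = bounded p (D - h.div z) := by
    choose m hm using fun P => exists_ord_eq (p := p P) hz
    ext w
    constructor
    · rintro ⟨y, hy, rfl⟩
      rw [SetLike.mem_coe, mem_bounded] at hy
      rw [mem_bounded]
      intro P
      rw [LinearMap.mulLeft_apply, (p P).ord.map_mul, hm P]
      refine le_trans (le_of_eq ?_) (add_le_add le_rfl (hy P))
      rw [← WithTop.coe_add, Finsupp.sub_apply, h.div_apply (hm P)]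
      congr 1
      ring
    · intro hw
      rw [mem_bounded] at hw
      refine ⟨z⁻¹ * w, mem_bounded.2 fun P => ?_, by simp [hz]⟩
      rw [(p P).ord.map_mul, ord_inv (hm P)]
      refine le_trans (le_of_eq ?_) (add_le_add le_rfl (hw P))
      rw [← WithTop.coe_add, Finsupp.sub_apply, h.div_apply (hm P)]
      congr 1
      ring
  have := Submodule.relDim_map_of_injective (LinearMap.mulLeft k z) (mul_right_injective₀ hz)
    ⊥ (bounded p D)
  rwa [Submodule.map_bot, hmap] at this

include h in
theorem relDim_bounded_ne_top (D : ι →₀ ℤ) : Submodule.relDim ⊥ (bounded p D) ≠ ⊤ := by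
  have h1 : Submodule.relDim ⊥ (bounded p D) ≤ Submodule.relDim ⊥ (bounded p (D ⊔ 0)) :=
    Submodule.relDim_mono_right _ (bounded_mono le_sup_left)
  refine ne_top_of_le_ne_top ?_ (h1.trans (relDim_bot_bounded_le (D := 0) le_sup_right))
  exact WithTop.add_ne_top.2 ⟨h.finite_const, ENat.natCast_ne_top _⟩

-- For multiples E of the pole divisor of x, `le_relDim_bounded_smul_poles` bounds deg E − ℓ(E). Any
-- D ≥ 0 is linearly equivalent to a divisor below some such E, and deg − ℓ does not decrease on
-- passing to a larger divisor.
include h in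
theorem exists_degree_le_relDim_bounded_add :
    ∃ γ : ℕ, ∀ D : ι →₀ ℤ, 0 ≤ D →
      ((degree p D).toNat : ℕ∞) ≤ Submodule.relDim ⊥ (bounded p D) + γ := by
  obtain ⟨x, hx0, hx⟩ : ∃ x : K, x ≠ 0 ∧ Transcendental k x := by
    obtain ⟨t, ht0, ht⟩ := (p (Classical.arbitrary ι)).exists_ord_eq_int 1
    exact ⟨t, ht0, transcendental_of_ord_pos ht0 (by rw [ht]; norm_cast)⟩
  obtain ⟨C, hC, hl⟩ := h.le_relDim_bounded_smul_poles hx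
  have hC0 := degree_nonneg p hC
  have := h.finite_adjoin x hx
  set n := Module.finrank k⟮x⟯ K with hn
  have hn0 : 0 < n := Module.finrank_pos
  refine ⟨(degree p C).toNat, fun D hD => ?_⟩
  have hD0 := degree_nonneg p hD
  -- Large enough for ℓ(E) ≥ l + 1 − deg C > deg D, so that E − D has a nonzero section z.
  set l := (degree p C).toNat + (degree p D).toNat
  set E := l • h.poles x with hE
  have hdegE : degree p E = l * n := by
    rw [hE, map_nsmul, h.degree_poles hx, nsmul_eq_mul]
  have h1 : (((l + 1) * n : ℕ) : ℕ∞) ≤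
      Submodule.relDim ⊥ (bounded p E) + ((degree p C).toNat : ℕ∞) := by
    refine (hl l).trans ?_
    have := relDim_bot_bounded_le (p := p) (show E ≤ C + E from le_add_of_nonneg_left hC)
    rwa [map_add, add_sub_cancel_right] at this
  obtain ⟨e, he⟩ := ENat.ne_top_iff_exists.1 (h.relDim_bounded_ne_top E)
  rw [← he] at h1
  norm_cast at h1
  have h2 : Submodule.relDim ⊥ (bounded p (E - D)) ≠ 0 := by
    intro h0
    have := relDim_bot_bounded_le (p := p) (show E - D ≤ E from sub_le_self _ hD)
    rw [h0, zero_add, ← he, map_sub, sub_sub_cancel] at this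
    norm_cast at this
    have hln : l + 1 ≤ (l + 1) * n := Nat.le_mul_of_pos_right _ hn0
    have hldef : l = (degree p C).toNat + (degree p D).toNat := rfl
    omega
  obtain ⟨z, hz, hz0⟩ : ∃ z ∈ bounded p (E - D), z ≠ 0 := by
    by_contra! hc
    refine h2 (Submodule.relDim_eq_zero.2 fun z hz => ?_)
    simpa using hc z hz
  have hle : D - h.div z ≤ E := by
    intro P
    obtain ⟨m, hm⟩ := exists_ord_eq (p := p P) hz0
    have := mem_bounded.1 hz P
    rw [hm] at this
    rw [Finsupp.sub_apply, h.div_apply hm]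
    rw [Finsupp.sub_apply] at this
    norm_cast at this
    omega
  have h3 := relDim_bot_bounded_le (p := p) hle
  rw [h.relDim_bounded_sub_div hz0, map_sub, h.degree_div z hz0, sub_zero, ← he] at h3
  obtain ⟨d, hd⟩ := ENat.ne_top_iff_exists.1 (h.relDim_bounded_ne_top D)
  rw [← hd] at h3 ⊢
  have h4 : degree p D ≤ degree p E := by
    have := degree_nonneg p (sub_nonneg.2 hle)
    rw [map_sub, map_sub, h.degree_div z hz0] at this
    omega
  norm_cast at h3 ⊢
  zify at h1 h3 ⊢
  rw [Int.toNat_of_nonneg hC0] at *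
  rw [Int.toNat_of_nonneg (sub_nonneg.2 h4)] at h3
  rw [Int.toNat_of_nonneg hD0]
  nlinarith

-- Finitely many independent classes already live in poles bounded by one divisor D ≥ 0. There
-- `relDim_bounded_add` and the uniform bound on deg D − ℓ(D) limit their number.
include h in
theorem relDim_allRepartitions_ne_top :
    Submodule.relDim (adele p 0 ⊔ LinearMap.range (diag k K ι)) (allRepartitions p) ≠ ⊤ := by
  obtain ⟨γ, hγ⟩ := h.exists_degree_le_relDim_bounded_add
  obtain ⟨c, hc⟩ := ENat.ne_top_iff_exists.1 h.finite_const
  intro htop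
  obtain ⟨b, hb, hbli⟩ := Submodule.exists_linearIndependent_mkQ
    (A := adele p 0 ⊔ LinearMap.range (diag k K ι)) (B := allRepartitions p) (N := c + γ + 1)
    (by rw [htop]; exact le_top)
  obtain ⟨D, hD0, hD⟩ := exists_mem_adele hb
  have h1 := Submodule.card_le_relDim (B := adele p D ⊔ LinearMap.range (diag k K ι)) b
    (fun i => Submodule.mem_sup_left (hD i)) hbli
  have h2 := relDim_bounded_add (p := p) hD0
  have h3 := Submodule.relDim_add (bot_le (a := bounded p 0)) (bounded_mono hD0)
  have h4 := hγ D hD0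
  rw [← hc] at h3
  rw [map_zero, sub_zero] at h2
  rw [← h2, ← h3] at h4
  have hfin : Submodule.relDim (bounded p 0) (bounded p D) ≠ ⊤ :=
    ne_top_of_le_ne_top (ENat.natCast_ne_top _) (relDim_bounded_le hD0)
  obtain ⟨a, ha⟩ := ENat.ne_top_iff_exists.1 hfin
  have hfin' : Submodule.relDim (adele p 0 ⊔ LinearMap.range (diag k K ι))
      (adele p D ⊔ LinearMap.range (diag k K ι)) ≠ ⊤ :=
    ne_top_of_le_ne_top (ENat.natCast_ne_top _) (h2 ▸ le_add_self)
  obtain ⟨s, hs⟩ := ENat.ne_top_iff_exists.1 hfin'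
  rw [← ha, ← hs] at h4
  rw [← hs, Fintype.card_fin] at h1
  norm_cast at h1 h4
  omega

include h in
/-- **Riemann's inequality** -/
theorem degree_add_one_le {D : ι →₀ ℤ} (hD : 0 ≤ D) :
    ((degree p D).toNat : ℕ∞) + 1 ≤ Submodule.relDim ⊥ (bounded p D) +
      Submodule.relDim (adele p 0 ⊔ LinearMap.range (diag k K ι)) (allRepartitions p) := by
  -- The summand 1 of the inequality comes from the constants: ℓ(0) ≥ 1.
  have h1 : 1 ≤ Submodule.relDim ⊥ (bounded p 0) := by
    rw [Order.one_le_iff_ne_zero, Ne, Submodule.relDim_eq_zero]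
    intro hle
    have : (1 : K) ∈ bounded p 0 := mem_bounded.2 fun P => by simp
    simpa using hle this
  have h2 := relDim_bounded_add (p := p) hD
  have h3 := Submodule.relDim_add (bot_le (a := bounded p 0)) (bounded_mono hD)
  have h4 : Submodule.relDim (adele p 0 ⊔ LinearMap.range (diag k K ι))
      (adele p D ⊔ LinearMap.range (diag k K ι)) ≤
      Submodule.relDim (adele p 0 ⊔ LinearMap.range (diag k K ι)) (allRepartitions p) :=
    Submodule.relDim_mono_right _
      (sup_le (adele_le_allRepartitions D) h.range_diag_le_allRepartitions)
  rw [map_zero, sub_zero] at h2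
  rw [← h2, ← h3, add_comm, ← add_assoc]
  gcongr

end IsComplete

end Place

/-! ### Quadratic forms as sums of monomials -/

section Quad

variable {σ τ R : Type*} [CommRing R]

/-- The quadratic form with terms `c e * t (i e) * t (j e)`. -/
def quadEval (s : Finset σ) (c : σ → R) (i j : σ → τ) (x : τ → R) : R :=
  ∑ e ∈ s, c e * (x (i e) * x (j e))

/-- The polar form of `quadEval`. -/
def quadPolar (s : Finset σ) (c : σ → R) (i j : σ → τ) (x y : τ → R) : R :=
  ∑ e ∈ s, c e * (x (i e) * y (j e) + y (i e) * x (j e))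

variable (s : Finset σ) (c : σ → R) (i j : σ → τ)

theorem quadEval_lin (r t : R) (x y : τ → R) :
    quadEval s c i j (fun l => r * x l + t * y l) =
      r ^ 2 * quadEval s c i j x + r * t * quadPolar s c i j x y + t ^ 2 * quadEval s c i j y := by
  simp only [quadEval, quadPolar, Finset.mul_sum, ← Finset.sum_add_distrib]
  exact Finset.sum_congr rfl fun e _ => by ring

theorem quadPolar_lin (r : R) (x y z : τ → R) :
    quadPolar s c i j x (fun l => y l + r * z l) =
      quadPolar s c i j x y + r * quadPolar s c i j x z := by
  simp only [quadPolar, Finset.mul_sum, ← Finset.sum_add_distrib]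
  exact Finset.sum_congr rfl fun e _ => by ring

theorem quadPolar_self (x : τ → R) : quadPolar s c i j x x = 2 * quadEval s c i j x := by
  simp only [quadEval, quadPolar, Finset.mul_sum]
  exact Finset.sum_congr rfl fun e _ => by ring

/-- The image of `a` under the reflection in `x`, cleared of denominators. -/
def quadReflect (a x : τ → R) (l : τ) : R :=
  quadEval s c i j x * a l + -quadPolar s c i j a x * x l

theorem quadEval_quadReflect {a : τ → R} (ha : quadEval s c i j a = 0) (x : τ → R) :
    quadEval s c i j (quadReflect s c i j a x) = 0 := by
  have := quadEval_lin s c i j (quadEval s c i j x) (-quadPolar s c i j a x) a x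
  rw [ha] at this
  refine this.trans ?_
  ring

/-- As a is isotropic, q(e + ra) = q(e) + rB(a,e) and B(a, e + ra) = B(a,e), so the extra terms
cancel. Hence only the distance of x from the line through a matters for the size of the reflected
vector. -/
theorem quadReflect_add_mul {a : τ → R} (ha : quadEval s c i j a = 0) (r : R) (e : τ → R) :
    quadReflect s c i j a (fun l => e l + r * a l) = quadReflect s c i j a e := by
  funext l
  have h1 := quadEval_lin s c i j 1 r e a
  have h2 := quadPolar_lin s c i j r a e a
  rw [quadPolar_self, ha, mul_zero, mul_zero, add_zero] at h2
  have h3 : quadPolar s c i j e a = quadPolar s c i j a e := by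
    simp only [quadPolar]
    exact Finset.sum_congr rfl fun e _ => by ring
  simp only [one_mul, one_pow, ha, h3] at h1
  rw [quadReflect, quadReflect, h1, h2]
  ring

/-- If q(x)a = B(a,x)x, applying q gives 0 = B(a,x)²q(x), so B(a,x) = 0 and then a = 0. -/
theorem quadReflect_ne_zero [IsDomain R] {a x : τ → R} (ha0 : a ≠ 0) (ha : quadEval s c i j a = 0)
    (hx : quadEval s c i j x ≠ 0) : quadReflect s c i j a x ≠ 0 := by
  intro h0
  have hq : ∀ l, quadEval s c i j x * a l = quadPolar s c i j a x * x l := fun l => by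
    have := congrFun h0 l
    simp only [quadReflect, Pi.zero_apply] at this
    linear_combination this
  have e0 : ∀ (r : R) (y : τ → R), quadEval s c i j (fun l => r * y l) =
      r ^ 2 * quadEval s c i j y := fun r y => by
    have := quadEval_lin s c i j r 0 y y
    simpa using this
  have h1 := e0 (quadEval s c i j x) a
  rw [funext hq, e0, ha, mul_zero] at h1
  have h2 : quadPolar s c i j a x = 0 := by
    simpa [hx] using h1
  apply ha0
  funext l
  have := hq l
  rw [h2, zero_mul] at this
  simpa [hx] using this

/-- Summing over monomials instead of using a symmetric matrix keeps the coefficients of f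
themselves and avoids halves. -/
theorem MvPolynomial.IsHomogeneous.exists_eval_eq_quadEval [Nonempty τ]
    {f : MvPolynomial τ R} (hf : f.IsHomogeneous 2) :
    ∃ i j : (τ →₀ ℕ) → τ, ∀ x, eval x f = quadEval f.support (fun d => f.coeff d) i j x := by
  have h1 : ∀ d : τ →₀ ℕ, ∃ a b : τ, d ∈ f.support →
      d = Finsupp.single a 1 + Finsupp.single b 1 := by
    intro d
    by_cases hd : d ∈ f.support
    swap
    · exact ⟨Classical.arbitrary _, Classical.arbitrary _, fun h => absurd h hd⟩
    have hd2 : d.degree = 2 := by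
      rw [Finsupp.degree_eq_weight_one]
      exact hf (mem_support_iff.1 hd)
    have hcard : (Finsupp.toMultiset d).card = 2 := by
      rw [Finsupp.card_toMultiset, ← hd2]
      rfl
    obtain ⟨a, b, hab⟩ := Multiset.card_eq_two.1 hcard
    classical
    refine ⟨a, b, fun _ => Multiset.toFinsupp.symm.injective ?_⟩
    change Finsupp.toMultiset d = Finsupp.toMultiset _
    rw [hab, map_add, Finsupp.toMultiset_single, Finsupp.toMultiset_single]
    simp
  choose i j hij using h1
  refine ⟨i, j, fun x => ?_⟩
  rw [eval_eq, quadEval]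
  refine Finset.sum_congr rfl fun d hd => ?_
  congr 1
  change (d.support.prod fun l => x l ^ d l) = _
  change d.prod (fun l m => x l ^ m) = _
  conv_lhs => rw [hij d hd]
  rw [Finsupp.prod_add_index' (by simp) (fun _ _ _ => pow_add _ _ _)]
  simp

end Quad

/-! ### Approximation of multiples of a vector -/

namespace Place

variable {k K ι : Type*} [Field k] [Field K] [Algebra k K]

section

variable {σ τ : Type*} {q : Place k K} {s : Finset σ} {c : σ → K} {i j : σ → τ} {φ m m' : ℤ}
  {x y : τ → K}

theorem le_ord_mul {a b : ℤ} {x y : K} (hx : (a : WithTop ℤ) ≤ q.ord x)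
    (hy : (b : WithTop ℤ) ≤ q.ord y) : ((a + b : ℤ) : WithTop ℤ) ≤ q.ord (x * y) := by
  rw [q.ord.map_mul, WithTop.coe_add]
  exact add_le_add hx hy

theorem le_ord_quadEval (hc : ∀ e ∈ s, (φ : WithTop ℤ) ≤ q.ord (c e))
    (hx : ∀ l, (m : WithTop ℤ) ≤ q.ord (x l)) :
    ((φ + (m + m) : ℤ) : WithTop ℤ) ≤ q.ord (quadEval s c i j x) :=
  q.ord.map_le_sum fun e he => le_ord_mul (hc e he) (le_ord_mul (hx _) (hx _))

theorem le_ord_quadPolar (hc : ∀ e ∈ s, (φ : WithTop ℤ) ≤ q.ord (c e))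
    (hx : ∀ l, (m : WithTop ℤ) ≤ q.ord (x l)) (hy : ∀ l, (m' : WithTop ℤ) ≤ q.ord (y l)) :
    ((φ + (m + m') : ℤ) : WithTop ℤ) ≤ q.ord (quadPolar s c i j x y) := by
  refine q.ord.map_le_sum fun e he => le_ord_mul (hc e he) (q.ord.map_le_add
    (le_ord_mul (hx _) (hy _)) ?_)
  rw [add_comm m]
  exact le_ord_mul (hy _) (hx _)

theorem le_ord_quadReflect (hc : ∀ e ∈ s, (φ : WithTop ℤ) ≤ q.ord (c e))
    (hx : ∀ l, (m : WithTop ℤ) ≤ q.ord (x l)) (hy : ∀ l, (m' : WithTop ℤ) ≤ q.ord (y l)) (l : τ) :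
    ((φ + m + 2 * m' : ℤ) : WithTop ℤ) ≤ q.ord (quadReflect s c i j x y l) := by
  refine q.ord.map_le_add ?_ ?_
  · rw [show φ + m + 2 * m' = φ + (m' + m') + m by ring]
    exact le_ord_mul (le_ord_quadEval hc hy) (hx l)
  · rw [show φ + m + 2 * m' = φ + (m + m') + m' by ring]
    refine le_ord_mul ?_ (hy l)
    rw [q.ord.map_neg]
    exact le_ord_quadPolar hc hx hy

end

namespace IsComplete

variable {p : ι → Place k K} (h : IsComplete p) [Nonempty ι]

-- The product formula: zeros outside S contribute nonnegatively, so the part of the divisor on S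
-- has degree at most 0.
include h in
theorem sum_deg_mul_ord_nonpos {S : Finset ι} {z : K} (hz : z ≠ 0)
    (hS : ∀ P ∉ S, 0 ≤ (p P).ord z) {m : ι → ℤ} (hm : ∀ P ∈ S, (m P : WithTop ℤ) ≤ (p P).ord z) :
    ∑ P ∈ S, m P * ((p P).deg : ℤ) ≤ 0 := by
  classical
  choose v hv using fun P => exists_ord_eq (p := p P) hz
  have h1 := h.degree_div z hz
  rw [degree_eq_sum p (s := (h.div z).support ∪ S) Finset.subset_union_left,
    ← Finset.sum_sdiff (Finset.subset_union_right (s₁ := (h.div z).support) (s₂ := S))] at h1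
  have h2 : 0 ≤ ∑ P ∈ ((h.div z).support ∪ S) \ S, h.div z P * ((p P).deg : ℤ) := by
    refine Finset.sum_nonneg fun P hP => mul_nonneg ?_ (by positivity)
    have := hS P (Finset.mem_sdiff.1 hP).2
    rw [hv P] at this
    rw [h.div_apply (hv P)]
    exact_mod_cast this
  have h3 : ∑ P ∈ S, m P * ((p P).deg : ℤ) ≤ ∑ P ∈ S, h.div z P * ((p P).deg : ℤ) := by
    refine Finset.sum_le_sum fun P hP => mul_le_mul_of_nonneg_right ?_ (by positivity)
    have := hm P hP
    rw [hv P] at this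
    rw [h.div_apply (hv P)]
    exact_mod_cast this
  linarith

-- A dimension count in L(D)ⁿ, D being m times the sum of the points of S. Its dimension is at least
-- n(m Σ d_P + 1 − g), while the conditions at P cost at most d_P((α_P + m) + (n − 1)(β_P + m)); m
-- cancels and `hpos` remains.
include h in
theorem exists_approx_multiple {g : ℕ} (hg : Submodule.relDim
      (adele p 0 ⊔ LinearMap.range (diag k K ι)) (allRepartitions p) = g)
    (S : Finset ι) {n : ℕ} (a : Fin n → K) (i₀ : ι → Fin n) (ha0 : ∀ P, a (i₀ P) ≠ 0)
    (ha : ∀ P i, (p P).ord (a (i₀ P)) ≤ (p P).ord (a i)) {α β : ι → ℤ} (hαβ : ∀ P, α P ≤ β P)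
    (hpos : 0 < (n : ℤ) - n * g - ∑ P ∈ S, α P * ((p P).deg : ℤ)
      - (n - 1) * ∑ P ∈ S, β P * ((p P).deg : ℤ)) :
    ∃ x : Fin n → K, x ≠ 0 ∧ (∀ P ∉ S, ∀ i, 0 ≤ (p P).ord (x i)) ∧
      ∀ P ∈ S, (∀ i, (α P : WithTop ℤ) ≤ (p P).ord (x i)) ∧
        ∃ c : K, ∀ i, (β P : WithTop ℤ) ≤ (p P).ord (x i - c * a i) := by
  classical
  have hratio : ∀ P i, ((0 : ℤ) : WithTop ℤ) ≤ (p P).ord (a i / a (i₀ P)) := by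
    intro P i
    obtain ⟨v, hv⟩ := exists_ord_eq (p := p P) (ha0 P)
    have h1 := ha P i
    rw [hv] at h1
    rw [div_eq_mul_inv, show (0 : ℤ) = v + -v by ring]
    exact le_ord_mul h1 (ord_inv hv).ge
  -- Poles of order m must be allowed generously enough for the bounds α and β to be restrictions of
  -- them.
  obtain ⟨m, hmα, hmβ⟩ : ∃ m : ℕ, (∀ P ∈ S, -(m : ℤ) ≤ α P) ∧ ∀ P ∈ S, -(m : ℤ) ≤ β P := by
    have hm : ∀ P ∈ S, -((∑ P ∈ S, (α P).natAbs : ℕ) : ℤ) ≤ α P := by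
      intro P hP
      have := Finset.single_le_sum (f := fun P => (α P).natAbs) (fun _ _ => Nat.zero_le _) hP
      omega
    exact ⟨_, hm, fun P hP => (hm P hP).trans (hαβ P)⟩
  let D : ι →₀ ℤ := Finsupp.indicator S fun _ _ => (m : ℤ)
  have hDS : ∀ P ∈ S, D P = m := fun P hP => Finsupp.indicator_of_mem hP _
  have hDS' : ∀ P ∉ S, D P = 0 := fun P hP => Finsupp.indicator_of_notMem hP _
  have hD0 : 0 ≤ D := by
    intro P
    by_cases hP : P ∈ S
    · simp [hDS P hP]
    · simp [hDS' P hP]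
  have hdegD : degree p D = m * ∑ P ∈ S, ((p P).deg : ℤ) := by
    rw [degree_eq_sum p (Finsupp.support_indicator_subset S _), Finset.mul_sum]
    exact Finset.sum_congr rfl fun P hP => by rw [hDS P hP]
  obtain ⟨L, hL⟩ := ENat.ne_top_iff_exists.1 (h.relDim_bounded_ne_top D)
  have hRiem := h.degree_add_one_le hD0
  rw [hg, ← hL] at hRiem
  have hRiem' : m * ∑ P ∈ S, ((p P).deg : ℤ) + 1 ≤ L + g := by
    norm_cast at hRiem
    zify at hRiem
    rwa [Int.toNat_of_nonneg (degree_nonneg p hD0), hdegD] at hRiem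
  let ψ : (Fin n → bounded p D) →ₗ[k] (Fin n → K) :=
    LinearMap.pi fun i => (bounded p D).subtype ∘ₗ LinearMap.proj i
  have hψ : Function.Injective ψ := fun u v huv => by
    funext i
    exact Subtype.ext (congrFun huv i)
  set V := LinearMap.range ψ with hV
  have hVlen : Submodule.relDim ⊥ V = ((n * L : ℕ) : ℕ∞) := by
    rw [Submodule.relDim_bot, ← (LinearEquiv.ofInjective ψ hψ).length_eq, Module.length_pi,
      ← Submodule.relDim_bot, ← hL]
    simp
  have hVmem : ∀ x ∈ V, ∀ i, x i ∈ bounded p D := by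
    rintro _ ⟨u, rfl⟩ i
    exact (u i).2
  -- At P, keep the pivot coordinate i₀ and replace the others by their deviation from
  -- (x_{i₀}/a_{i₀})a. The pivot entry of a has least order, so the ratios are integral and Φ does
  -- not worsen the poles.
  let Φ : (Fin n → K) →ₗ[k] (S × Fin n → K) := LinearMap.pi fun q =>
    if q.2 = i₀ q.1 then LinearMap.proj q.2 else
      LinearMap.proj q.2 - LinearMap.mulLeft k (a q.2 / a (i₀ q.1)) ∘ₗ
        (LinearMap.proj (i₀ q.1) : (Fin n → K) →ₗ[k] K)
  have hΦ : ∀ x (P : S) i, Φ x (P, i) =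
      if i = i₀ P then x i else x i - a i / a (i₀ P) * x (i₀ P) := by
    intro x P i
    simp only [Φ, LinearMap.pi_apply]
    split_ifs <;> simp
  let q : S × Fin n → Place k K := fun r => p r.1
  let G : S × Fin n →₀ ℤ := Finsupp.equivFunOnFinite.symm fun r =>
    if r.2 = i₀ r.1 then -α r.1 else -β r.1
  let M : S × Fin n →₀ ℤ := Finsupp.equivFunOnFinite.symm fun r => m
  have hG : ∀ r, G r = if r.2 = i₀ r.1 then -α r.1 else -β r.1 := fun r => rfl
  have hGM : G ≤ M := by
    intro r
    have h1 := hmα r.1 r.1.2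
    have h2 := hmβ r.1 r.1.2
    rw [hG, show M r = m from rfl]
    split_ifs <;> omega
  have hmap : V.map Φ ≤ adele q M := by
    rintro _ ⟨x, hx, rfl⟩
    rw [mem_adele]
    rintro ⟨P, i⟩
    have hxP : ∀ i, ((-(m : ℤ) : ℤ) : WithTop ℤ) ≤ (p P).ord (x i) := fun i => by
      have := mem_bounded.1 (hVmem x hx i) P
      rwa [hDS P P.2] at this
    rw [hΦ]
    change ((-(m : ℤ) : ℤ) : WithTop ℤ) ≤ (p P).ord _
    split_ifs
    · exact hxP i
    · refine (p P).ord.map_le_sub (hxP i) ?_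
      simpa using le_ord_mul (hratio P i) (hxP (i₀ P))
  have hdeg : degree q M - degree q G = n * m * ∑ P ∈ S, ((p P).deg : ℤ) +
      ∑ P ∈ S, α P * ((p P).deg : ℤ) + (n - 1) * ∑ P ∈ S, β P * ((p P).deg : ℤ) := by
    rw [degree_eq_sum q (D := M) (Finset.subset_univ _),
      degree_eq_sum q (D := G) (Finset.subset_univ _), ← Finset.sum_sub_distrib,
      Fintype.sum_prod_type, Finset.mul_sum, Finset.mul_sum, ← Finset.sum_add_distrib,
      ← Finset.sum_add_distrib, ← Finset.sum_coe_sort S]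
    refine Finset.sum_congr rfl fun P _ => ?_
    have e : ∀ i, M (P, i) * ((q (P, i)).deg : ℤ) - G (P, i) * ((q (P, i)).deg : ℤ) =
        (m + β P) * ((p P).deg : ℤ) + if i = i₀ P then (α P - β P) * ((p P).deg : ℤ) else 0 := by
      intro i
      rw [hG, show M (P, i) = m from rfl, show q (P, i) = p P from rfl]
      split_ifs <;> ring
    rw [Finset.sum_congr rfl fun i _ => e i, Finset.sum_add_distrib]
    simp
    ring
  -- If only 0 met the conditions, V would embed into a quotient of dimension deg M − deg G, which
  -- Riemann's inequality and `hpos` exclude.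
  by_cases hbot : ((adele q G).comap Φ) ⊓ V ≤ ⊥
  · exfalso
    have h1 : Submodule.relDim ⊥ V ≤ ((degree q M - degree q G).toNat : ℕ∞) := by
      rw [← eq_bot_iff.2 hbot, Submodule.relDim_inf_left, Submodule.relDim_comap_left,
        ← relDim_adele hGM]
      exact Submodule.relDim_mono_right _ hmap
    have h2 : 0 ≤ degree q M - degree q G := by
      rw [← map_sub]
      exact degree_nonneg q (sub_nonneg.2 hGM)
    rw [hVlen] at h1
    norm_cast at h1
    zify at h1
    rw [Int.toNat_of_nonneg h2, hdeg] at h1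
    have h3 : (n : ℤ) * (m * ∑ P ∈ S, ((p P).deg : ℤ) + 1) ≤ n * (L + g) :=
      mul_le_mul_of_nonneg_left hRiem' (by positivity)
    nlinarith
  · obtain ⟨x, ⟨hx, hxV⟩, hx0⟩ := Set.not_subset.1 hbot
    have hx0' : x ≠ 0 := by simpa using hx0
    refine ⟨x, hx0', fun P hP i => ?_, fun P hP => ?_⟩
    · have := mem_bounded.1 (hVmem x hxV i) P
      rw [hDS' P hP] at this
      simpa using this
    · have hxG := mem_adele.1 hx
      have hxα : (α P : WithTop ℤ) ≤ (p P).ord (x (i₀ P)) := by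
        have := hxG (⟨P, hP⟩, i₀ P)
        rw [hΦ, hG, if_pos rfl, if_pos rfl, neg_neg] at this
        exact this
      have hxβ : ∀ i, (β P : WithTop ℤ) ≤ (p P).ord (x i - a i / a (i₀ P) * x (i₀ P)) := by
        intro i
        by_cases hi : i = i₀ P
        · subst hi
          simp [div_self (ha0 P)]
        · have := hxG (⟨P, hP⟩, i)
          rw [hΦ, hG, if_neg hi, if_neg hi, neg_neg] at this
          exact this
      refine ⟨fun i => ?_, x (i₀ P) / a (i₀ P), fun i => ?_⟩
      · rw [show x i = (x i - a i / a (i₀ P) * x (i₀ P)) + a i / a (i₀ P) * x (i₀ P) by ring]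
        refine (p P).ord.map_le_add ((WithTop.coe_le_coe.2 (hαβ P)).trans (hxβ i)) ?_
        simpa using le_ord_mul (hratio P i) hxα
      · rw [show x (i₀ P) / a (i₀ P) * a i = a i / a (i₀ P) * x (i₀ P) by ring]
        exact hxβ i

end IsComplete

end Place

/-! ### Shortening isotropic vectors -/

namespace Place

namespace IsComplete

variable {k K ι : Type*} [Field k] [Field K] [Algebra k K]

variable {p : ι → Place k K} (h : IsComplete p) [Nonempty ι]

-- One descent step: `hlong` says that a exceeds the asserted bound, and then either the
-- approximating vector x or the reflection of a in x is shorter.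
include h in
theorem exists_shorter_isotropic {g : ℕ} (hg : Submodule.relDim
      (adele p 0 ⊔ LinearMap.range (diag k K ι)) (allRepartitions p) = g)
    {S : Finset ι} (hS : S.Nonempty) {n : ℕ} {σ : Type*} {s : Finset σ} {c : σ → K}
    {i j : σ → Fin n} (hcS : ∀ P ∉ S, ∀ e ∈ s, 0 ≤ (p P).ord (c e)) (hc0 : ∃ e ∈ s, c e ≠ 0)
    {φ : ι → ℤ} (hφ : ∀ P ∈ S, ∀ e ∈ s, (φ P : WithTop ℤ) ≤ (p P).ord (c e))
    {a : Fin n → K} (ha0 : a ≠ 0) (haq : quadEval s c i j a = 0)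
    (haS : ∀ P ∉ S, ∀ l, 0 ≤ (p P).ord (a l))
    {μ : ι → ℤ} (hμ : ∀ P ∈ S, ∀ l, (μ P : WithTop ℤ) ≤ (p P).ord (a l))
    (hlong : 2 * (∑ P ∈ S, ((p P).deg : ℤ) + g - 1) * n - (n - 1) * ∑ P ∈ S, φ P * ((p P).deg : ℤ) <
      -2 * ∑ P ∈ S, μ P * ((p P).deg : ℤ)) :
    ∃ w : Fin n → K, w ≠ 0 ∧ quadEval s c i j w = 0 ∧ (∀ P ∉ S, ∀ l, 0 ≤ (p P).ord (w l)) ∧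
      ∃ ν : ι → ℤ, (∀ P ∈ S, ∀ l, (ν P : WithTop ℤ) ≤ (p P).ord (w l)) ∧
        ∑ P ∈ S, μ P * ((p P).deg : ℤ) < ∑ P ∈ S, ν P * ((p P).deg : ℤ) := by
  classical
  obtain ⟨l₀, hl₀⟩ := Function.ne_iff.1 ha0
  have hn : 1 ≤ n := by
    have := l₀.2
    omega
  obtain ⟨e₀, he₀, hce₀⟩ := hc0
  have hμ0 : ∑ P ∈ S, μ P * ((p P).deg : ℤ) ≤ 0 :=
    h.sum_deg_mul_ord_nonpos hl₀ (fun P hP => haS P hP l₀) fun P hP => hμ P hP l₀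
  have hφ0 : ∑ P ∈ S, φ P * ((p P).deg : ℤ) ≤ 0 :=
    h.sum_deg_mul_ord_nonpos hce₀ (fun P hP => hcS P hP e₀ he₀) fun P hP => hφ P hP e₀ he₀
  have hi₀ : ∀ P, ∃ l, ∀ l', (p P).ord (a l) ≤ (p P).ord (a l') := fun P => by
    have : Nonempty (Fin n) := ⟨l₀⟩
    exact Finite.exists_min _
  choose i₀ hi₀ using hi₀
  have hai₀ : ∀ P, a (i₀ P) ≠ 0 := fun P h0 => by
    have := hi₀ P l₀
    rw [h0, (p P).ord.map_zero, top_le_iff, (p P).ord.top_iff] at this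
    exact hl₀ this
  -- The least integer above −φ_P/2: the reflection then gains at least one order at every P ∈ S, at
  -- the smallest cost in the count.
  obtain ⟨β, hβ⟩ : ∃ β : ι → ℤ, ∀ P, -φ P + 1 ≤ 2 * β P ∧ 2 * β P ≤ -φ P + 2 :=
    ⟨fun P => -φ P / 2 + 1, fun P => by dsimp only; omega⟩
  obtain ⟨P₀, hP₀⟩ := hS
  set d : ι → ℤ := fun P => ((p P).deg : ℤ) with hd
  have hdpos : ∀ P, 0 < d P := fun P => Int.natCast_pos.2 (p P).deg_pos
  have hd0 : d P₀ ≤ ∑ P ∈ S, d P :=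
    Finset.single_le_sum (f := d) (fun P _ => (hdpos P).le) hP₀
  have hβ1 : 2 * ∑ P ∈ S, β P * d P ≥ -∑ P ∈ S, φ P * d P + ∑ P ∈ S, d P := by
    rw [Finset.mul_sum, ← Finset.sum_neg_distrib, ← Finset.sum_add_distrib]
    exact Finset.sum_le_sum fun P _ => by nlinarith [hβ P, hdpos P]
  have hβ2 : 2 * ∑ P ∈ S, β P * d P ≤ -∑ P ∈ S, φ P * d P + 2 * ∑ P ∈ S, d P := by
    rw [Finset.mul_sum, Finset.mul_sum, ← Finset.sum_neg_distrib, ← Finset.sum_add_distrib]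
    exact Finset.sum_le_sum fun P _ => by nlinarith [hβ P, hdpos P]
  change ∑ P ∈ S, μ P * d P ≤ 0 at hμ0
  change ∑ P ∈ S, φ P * d P ≤ 0 at hφ0
  set sμ := ∑ P ∈ S, μ P * d P with hsμ
  set sφ := ∑ P ∈ S, φ P * d P with hsφ
  set sβ := ∑ P ∈ S, β P * d P with hsβ
  set sd := ∑ P ∈ S, d P with hsd
  -- Lowering β by t at P₀ alone gives α. This is the largest t for which x is still shorter than a;
  -- the rounding loss is below d P₀, which the sum of the degrees over S covers.
  obtain ⟨t, ht0, ht1, ht2⟩ : ∃ t : ℤ, 0 ≤ t ∧ t * d P₀ ≤ -sμ - 1 + sβ ∧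
      -sμ - 1 + sβ < t * d P₀ + d P₀ := by
    refine ⟨(-sμ - 1 + sβ) / d P₀, Int.ediv_nonneg ?_ (hdpos P₀).le,
      Int.ediv_mul_le _ (hdpos P₀).ne', ?_⟩
    · have := hdpos P₀
      omega
    · have := Int.lt_ediv_add_one_mul_self (-sμ - 1 + sβ) (hdpos P₀)
      linarith
  set α : ι → ℤ := fun P => if P = P₀ then β P - t else β P with hα
  have hαβ : ∀ P, α P ≤ β P := fun P => by
    simp only [hα]
    split_ifs <;> omega
  have hsα : ∑ P ∈ S, α P * d P = sβ - t * d P₀ := by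
    have e : ∀ P ∈ S, α P * d P = β P * d P - if P = P₀ then t * d P₀ else 0 := by
      intro P _
      simp only [hα]
      split_ifs with hP
      · subst hP; ring
      · ring
    rw [Finset.sum_congr rfl e, Finset.sum_sub_distrib]
    simp [hP₀, hsβ]
  have hn' : (1 : ℤ) ≤ n := by exact_mod_cast hn
  obtain ⟨x, hx0, hxS, hx⟩ := h.exists_approx_multiple hg S a i₀ hai₀ hi₀ hαβ (by
    change 0 < (n : ℤ) - n * g - ∑ P ∈ S, α P * d P - (n - 1) * ∑ P ∈ S, β P * d P
    rw [hsα, ← hsβ]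
    nlinarith [mul_le_mul_of_nonneg_left hβ2 (sub_nonneg.2 hn')])
  by_cases hqx : quadEval s c i j x = 0
  · refine ⟨x, hx0, hqx, hxS, α, fun P hP => (hx P hP).1, ?_⟩
    change sμ < ∑ P ∈ S, α P * d P
    rw [hsα]
    omega
  · refine ⟨quadReflect s c i j a x, quadReflect_ne_zero s c i j ha0 haq hqx,
      quadEval_quadReflect s c i j haq x, fun P hP l => ?_, fun P => φ P + μ P + 2 * β P,
      fun P hP l => ?_, ?_⟩
    · simpa using le_ord_quadReflect (q := p P) (φ := 0) (m := 0) (m' := 0) (hcS P hP)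
        (haS P hP) (hxS P hP) l
    · obtain ⟨-, r, hr⟩ := hx P hP
      have e : x = fun l => (x l - r * a l) + r * a l := by
        funext l
        ring
      rw [e, quadReflect_add_mul s c i j haq]
      exact le_ord_quadReflect (hφ P hP) (hμ P hP) hr l
    · change sμ < ∑ P ∈ S, (φ P + μ P + 2 * β P) * d P
      have e : ∑ P ∈ S, (φ P + μ P + 2 * β P) * d P = sφ + sμ + 2 * sβ := by
        rw [hsφ, hsμ, hsβ, Finset.mul_sum, ← Finset.sum_add_distrib, ← Finset.sum_add_distrib]
        exact Finset.sum_congr rfl fun P _ => by ring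
      rw [e]
      have := hdpos P₀
      omega

end IsComplete

end Place

/-! ### Étale algebras over principal ideal domains -/

section Etale

open Polynomial

/-- Being unramified, A has its maximal ideal at m generated by the contraction of m to B, which is
principal. -/
theorem IsDiscreteValuationRing.of_etale (B A : Type*) [CommRing B] [IsDomain B]
    [IsPrincipalIdealRing B] [CommRing A] [IsDomain A] [Algebra B A] [Algebra.Etale B A]
    (m : Ideal A) [m.IsPrime] (hm : m ≠ ⊥) : IsDiscreteValuationRing (Localization.AtPrime m) := by
  have : IsNoetherianRing A := Algebra.FiniteType.isNoetherianRing B A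
  let p := m.under B
  let := Localization.AtPrime.algebraOfLiesOver p m
  have : IsNoetherianRing (Localization.AtPrime m) :=
    IsLocalization.isNoetherianRing m.primeCompl _ inferInstance
  have h1 := ((Algebra.isUnramifiedAt_iff_map_eq B p m).1 inferInstance).2
  have h2 : (IsLocalRing.maximalIdeal (Localization.AtPrime m)).IsPrincipal := by
    rw [← h1]
    infer_instance
  exact ((IsDiscreteValuationRing.TFAE (Localization.AtPrime m)
    (IsLocalization.AtPrime.not_isField A hm (Localization.AtPrime m))).out 4 0).mp h2

/-- By Zariski's lemma such a field would be finite over k, yet it contains k[X]. -/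
theorem not_isField_of_etale (k A : Type*) [Field k] [CommRing A] [Algebra k[X] A]
    [Algebra.Etale k[X] A] : ¬ IsField A := by
  intro hA
  let := hA.toField
  let : Algebra k A := ((algebraMap k[X] A).comp C).toAlgebra
  have : IsScalarTower k k[X] A := .of_algebraMap_eq fun _ => rfl
  have : Algebra.FiniteType k A := .trans (S := k[X]) inferInstance inferInstance
  have : Module.Finite k A := finite_of_finite_type_of_isJacobsonRing k A
  have hinj : Function.Injective (algebraMap k[X] A) :=
    FaithfulSMul.algebraMap_injective _ _
  have := Module.Finite.of_injective (IsScalarTower.toAlgHom k k[X] A).toLinearMap hinj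
  exact Polynomial.not_finite this

/-- K is unramified and essentially of finite type over k(X), hence finite, so its transcendence
degree over k is 1. Thus K is algebraic over k(x), and finite because it is essentially of finite
type. -/
theorem finiteDimensional_adjoin_of_etale (k A K : Type*) [Field k] [CommRing A] [Field K]
    [Algebra k[X] A] [Algebra.Etale k[X] A] [Algebra A K] [IsFractionRing A K]
    [Algebra k K] (hk : ∀ c, algebraMap A K (algebraMap k[X] A (C c)) = algebraMap k K c)
    (x : K) (hx : Transcendental k x) :
    FiniteDimensional (IntermediateField.adjoin k {x}) K := by
  have : IsDomain A := (IsFractionRing.injective A K).isDomain _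
  let : Algebra k[X] K := ((algebraMap A K).comp (algebraMap k[X] A)).toAlgebra
  have : IsScalarTower k[X] A K := .of_algebraMap_eq fun _ => rfl
  have : IsScalarTower k k[X] K := .of_algebraMap_eq fun c => (hk c).symm
  have : FaithfulSMul k[X] K := by
    rw [faithfulSMul_iff_algebraMap_injective, IsScalarTower.algebraMap_eq k[X] A K]
    exact (IsFractionRing.injective A K).comp (FaithfulSMul.algebraMap_injective _ _)
  let := FractionRing.liftAlgebra k[X] K
  have : IsScalarTower k[X] (FractionRing k[X]) K := FractionRing.isScalarTower_liftAlgebra _ _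
  have : Algebra.EssFiniteType A K := .of_isLocalization _ (nonZeroDivisors A)
  have : Algebra.EssFiniteType k[X] K := .comp _ A _
  have : Algebra.FormallyUnramified A K := .of_isLocalization (nonZeroDivisors A)
  have : Algebra.FormallyUnramified k[X] K := .comp _ A _
  have : Algebra.EssFiniteType (FractionRing k[X]) K := .of_comp k[X] _ _
  have : Algebra.FormallyUnramified (FractionRing k[X]) K := .of_restrictScalars k[X] _ _
  have : Module.Finite (FractionRing k[X]) K := Algebra.FormallyUnramified.finite_of_free _ _
  have : Algebra.IsAlgebraic k[X] (FractionRing k[X]) :=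
    IsLocalization.isAlgebraic _ (nonZeroDivisors k[X])
  have : Algebra.IsAlgebraic k[X] K := .trans _ (FractionRing k[X]) _
  have hX : IsTranscendenceBasis k (algebraMap k[X] K ∘ fun _ : Unit => (X : k[X])) :=
    IsTranscendenceBasis.algebraMap_comp (IsTranscendenceBasis.polynomial (R := k) (ι := Unit))
  have htr := hX.lift_cardinalMk_eq_trdeg
  have hxi : AlgebraicIndependent k fun _ : Unit => x :=
    algebraicIndependent_unique_type_iff.2 hx
  have hxb := hxi.isTranscendenceBasis_of_lift_trdeg_le_of_finite (by rw [← htr])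
  have halg := hxb.isAlgebraic_field
  have : Set.range (fun _ : Unit => x) = {x} := by simp
  rw [this] at halg
  have : Algebra.EssFiniteType k K := .comp _ k[X] _
  have : Algebra.EssFiniteType (IntermediateField.adjoin k {x}) K := .of_comp k _ _
  exact Algebra.finite_of_essFiniteType_of_isAlgebraic

end Etale

/-! ### Local structure of a nice curve -/

namespace NiceCurve

variable {k : Type u} [Field k] (C : NiceCurve k)

open Polynomial in
-- Smoothness of relative dimension 1 means that locally the curve is étale over the affine line.
theorem exists_etale_coordinate (x : C.X) :
    ∃ (V : C.X.Opens) (_ : IsAffineOpen V) (_ : x ∈ V) (g : k[X] →+* Γ(C.X, V)),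
      g.Etale ∧ ∀ c, g (Polynomial.C c) =
        C.X.presheaf.map (homOfLE (le_top : V ≤ ⊤)).op (C.globalConst c) := by
  obtain ⟨U, hU, V, hV, hx, e, he⟩ :=
    C.smooth.exists_isStandardSmoothOfRelativeDimension x
  have hUtop : U = ⊤ := by
    ext y
    simp only [TopologicalSpace.Opens.coe_top, Set.mem_univ, iff_true]
    rw [Subsingleton.elim y (C.hom x)]
    exact e hx
  subst hUtop
  have h1 : ((C.hom.appLE ⊤ V e).hom.comp
      (Scheme.ΓSpecIso (CommRingCat.of k)).inv.hom).IsStandardSmoothOfRelativeDimension 1 :=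
    RingHom.isStandardSmoothOfRelativeDimension_respectsIso.2 _
      (Scheme.ΓSpecIso (CommRingCat.of k)).symm.commRingCatIsoToRingEquiv he
  obtain ⟨g, hgC, hg⟩ := h1.exists_etale_mvPolynomial
  refine ⟨V, hV, hx, g.comp (MvPolynomial.uniqueAlgEquiv k (Fin 1)).symm.toRingEquiv.toRingHom,
    RingHom.Etale.respectsIso.2 _ (MvPolynomial.uniqueAlgEquiv k (Fin 1)).symm.toRingEquiv hg,
    fun c => ?_⟩
  have h2 : (MvPolynomial.uniqueAlgEquiv k (Fin 1)).symm (Polynomial.C c) = MvPolynomial.C c :=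
    (MvPolynomial.uniqueAlgEquiv k (Fin 1)).symm.commutes c
  have h3 := congr($hgC c)
  simp only [RingHom.comp_apply] at h3
  rw [RingHom.comp_apply]
  erw [h2]
  rw [h3]
  rw [Scheme.Hom.appLE]
  rfl

instance isDiscreteValuationRing_stalk (P : C.ClosedPoint) :
    IsDiscreteValuationRing (C.X.presheaf.stalk P.1) := by
  obtain ⟨V, hV, hx, g, hg, -⟩ := C.exists_etale_coordinate P.1
  let := g.toAlgebra
  have : Algebra.Etale (Polynomial k) Γ(C.X, V) := hg
  have : Nonempty V := ⟨⟨_, hx⟩⟩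
  have hmax := hV.primeIdealOf_isMaximal_of_isClosed ⟨_, hx⟩ P.2
  let := C.X.presheaf.algebra_section_stalk ⟨_, hx⟩
  have := hV.isLocalization_stalk ⟨_, hx⟩
  have hm : (hV.primeIdealOf ⟨_, hx⟩).asIdeal ≠ ⊥ := by
    intro h0
    rw [h0] at hmax
    exact not_isField_of_etale k Γ(C.X, V) (Ring.isField_iff_maximal_bot.2 hmax)
  have := IsDiscreteValuationRing.of_etale (Polynomial k) Γ(C.X, V) _ hm
  exact IsDiscreteValuationRing.RingEquivClass.isDiscreteValuationRing (IsLocalization.algEquiv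
    (hV.primeIdealOf ⟨_, hx⟩).asIdeal.primeCompl
    (Localization.AtPrime (hV.primeIdealOf ⟨_, hx⟩).asIdeal) (C.X.presheaf.stalk P.1))

theorem finiteDimensional_adjoin (x : C.K) (hx : Transcendental k x) :
    FiniteDimensional (IntermediateField.adjoin k {x}) C.K := by
  obtain ⟨V, hV, hV', g, hg, hgC⟩ := C.exists_etale_coordinate (genericPoint C.X)
  let := g.toAlgebra
  have : Algebra.Etale (Polynomial k) Γ(C.X, V) := hg
  have : Nonempty V := ⟨⟨_, hV'⟩⟩
  have := functionField_isFractionRing_of_isAffineOpen C.X V hV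
  refine finiteDimensional_adjoin_of_etale k Γ(C.X, V) C.K (fun c => ?_) x hx
  rw [RingHom.algebraMap_toAlgebra g, hgC]
  exact C.X.presheaf.germ_res_apply _ _ _ _

open Order

theorem coheight_closedPoint (P : C.ClosedPoint) : coheight P.1 = 1 := by
  have h := ringKrullDim_stalk_eq_coheight P.1
  rw [IsDiscreteValuationRing.ringKrullDim_eq_one] at h
  exact_mod_cast h.symm

end NiceCurve

/-! ### Valuations and residue fields at the closed points -/

namespace NiceCurve

variable {k : Type u} [Field k] {C : NiceCurve k}

open Order

namespace ClosedPoint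

variable (P : C.ClosedPoint)

theorem ordHom_algebraMap_ge_one {y : C.X.presheaf.stalk P.1} (hy : y ≠ 0) :
    1 ≤ Scheme.ordHom P.1 (C.coheight_closedPoint P) (algebraMap _ C.K y) :=
  have : Ring.KrullDimLE 1 (C.X.presheaf.stalk P.1) :=
    krullDimLE_of_coheight_le (C.coheight_closedPoint P).le
  Ring.ordFrac_ge_one_of_ne_zero hy

theorem ordHom_algebraMap_eq_one_iff {y : C.X.presheaf.stalk P.1} :
    Scheme.ordHom P.1 (C.coheight_closedPoint P) (algebraMap _ C.K y) = 1 ↔ IsUnit y :=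
  have : Ring.KrullDimLE 1 (C.X.presheaf.stalk P.1) :=
    krullDimLE_of_coheight_le (C.coheight_closedPoint P).le
  (Ring.isUnit_iff_ordFrac_one_of_isDiscreteValuationRing).symm

theorem exists_ordHom_eq :
    ∃ t : C.K, Scheme.ordHom P.1 (C.coheight_closedPoint P) t = WithZero.exp 1 := by
  have : Ring.KrullDimLE 1 (C.X.presheaf.stalk P.1) :=
    krullDimLE_of_coheight_le (C.coheight_closedPoint P).le
  obtain ⟨t, ht⟩ := IsDiscreteValuationRing.exists_irreducible (C.X.presheaf.stalk P.1)
  exact ⟨_, Ring.ordFrac_irreducible ht⟩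

open scoped Classical in
/-- The order of a rational function at a closed point, as a valuation. -/
noncomputable def ordVal : AddValuation C.K (WithTop ℤ) :=
  AddValuation.of (fun x => if x = 0 then ⊤ else ((Scheme.ord x P.1 : ℤ) : WithTop ℤ))
    (by simp)
    (by
      have h : Scheme.ord (1 : C.K) P.1 = 0 := by
        rw [Scheme.ord_eq_iff (C.coheight_closedPoint P) one_ne_zero]
        simp
      simp [h])
    (fun x y => by
      by_cases hx : x = 0
      · simp [hx]
      by_cases hy : y = 0
      · simp [hy]
      by_cases hxy : x + y = 0
      · simp [hxy]
      rw [if_neg hx, if_neg hy, if_neg hxy, ← WithTop.coe_min]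
      exact WithTop.coe_le_coe.2 (Scheme.ord_add hxy))
    (fun x y => by
      by_cases hx : x = 0
      · simp [hx]
      by_cases hy : y = 0
      · simp [hy]
      rw [if_neg hx, if_neg hy, if_neg (mul_ne_zero hx hy), Scheme.ord_mul hx hy,
        WithTop.coe_add])

variable {P}

theorem ordVal_of_ne_zero {x : C.K} (hx : x ≠ 0) : P.ordVal x = (Scheme.ord x P.1 : ℤ) :=
  if_neg hx

theorem le_ordVal_iff {x : C.K} (hx : x ≠ 0) {n : ℤ} : (n : WithTop ℤ) ≤ P.ordVal x ↔
    WithZero.exp n ≤ Scheme.ordHom P.1 (C.coheight_closedPoint P) x := by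
  rw [ordVal_of_ne_zero hx, WithTop.coe_le_coe, Scheme.le_ord_iff (C.coheight_closedPoint P) hx]
  rfl

theorem ordVal_eq_iff {x : C.K} (hx : x ≠ 0) {n : ℤ} : P.ordVal x = (n : WithTop ℤ) ↔
    Scheme.ordHom P.1 (C.coheight_closedPoint P) x = WithZero.exp n := by
  rw [ordVal_of_ne_zero hx, WithTop.coe_inj, Scheme.ord_eq_iff (C.coheight_closedPoint P) hx]
  rfl

theorem ordVal_algebraMap_nonneg (y : C.X.presheaf.stalk P.1) :
    0 ≤ P.ordVal (algebraMap _ C.K y) := by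
  by_cases hy : y = 0
  · simp [hy]
  have := (le_ordVal_iff (P := P) (n := 0) (x := algebraMap _ C.K y) (by simpa)).2
    (P.ordHom_algebraMap_ge_one hy)
  simpa

theorem ordVal_algebraMap_eq_zero_iff {y : C.X.presheaf.stalk P.1} :
    P.ordVal (algebraMap _ C.K y) = 0 ↔ IsUnit y := by
  by_cases hy : y = 0
  · simp [hy]
  have := ordVal_eq_iff (P := P) (n := 0) (x := algebraMap _ C.K y) (by simpa)
  rw [WithTop.coe_zero] at this
  rw [this, ← ordHom_algebraMap_eq_one_iff]
  rfl

theorem mem_localRing_iff {x : C.K} : x ∈ P.localRing ↔ 0 ≤ P.ordVal x := by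
  change x ∈ (algebraMap (C.X.presheaf.stalk P.1) C.K).range ↔ _
  constructor
  · rintro ⟨y, rfl⟩
    exact ordVal_algebraMap_nonneg y
  · intro hx
    obtain ⟨y, hy⟩ | ⟨y, hy⟩ :=
      ValuationRing.isInteger_or_isInteger (C.X.presheaf.stalk P.1) x
    · exact ⟨y, hy⟩
    · by_cases hx0 : x = 0
      · exact ⟨0, by simp [hx0]⟩
      have h1 := ordVal_algebraMap_nonneg y
      have h2 := P.ordVal.map_mul x (algebraMap _ C.K y)
      rw [hy, mul_inv_cancel₀ hx0, P.ordVal.map_one] at h2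
      have h3 : IsUnit y := by
        rw [← ordVal_algebraMap_eq_zero_iff]
        rw [hy] at h1 ⊢
        refine le_antisymm ?_ h1
        rw [h2]
        exact le_add_of_nonneg_left hx
      obtain ⟨u, rfl⟩ := h3
      refine ⟨(u⁻¹ : (C.X.presheaf.stalk P.1)ˣ), ?_⟩
      rw [map_units_inv, hy, inv_inv]

variable (P)

theorem ordVal_const_nonneg (c : k) : 0 ≤ P.ordVal (algebraMap k C.K c) :=
  mem_localRing_iff.1 (P.localRing.algebraMap_mem c)

theorem exists_ordVal_eq_one : ∃ t, P.ordVal t = 1 := by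
  obtain ⟨t, ht⟩ := P.exists_ordHom_eq
  have h0 : t ≠ 0 := by
    rintro rfl
    rw [map_zero] at ht
    exact WithZero.exp_ne_zero ht.symm
  exact ⟨t, (ordVal_eq_iff h0).2 ht⟩

/-- A constant as an element of the stalk at a closed point. -/
noncomputable def constStalk : k →+* C.X.presheaf.stalk P.1 :=
  (C.X.presheaf.germ ⊤ P.1 trivial).hom.comp C.globalConst

theorem algebraMap_constStalk (c : k) :
    algebraMap _ C.K (P.constStalk c) = algebraMap k C.K c :=
  C.X.presheaf.germ_stalkSpecializes_apply _ _ _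

/-- Spec κ(P) is a closed subscheme, hence of finite type over k, and the Nullstellensatz makes it
finite. -/
theorem finite_residue_comp_constStalk :
    ((C.X.residue P.1).hom.comp P.constStalk).Finite := by
  have := C.proper
  have := isClosed_singleton_iff_isClosedImmersion.mp P.2
  have : IsFinite (C.X.fromSpecResidueField P.1 ≫ C.hom) := by
    rw [isFinite_iff_locallyOfFiniteType_of_jacobsonSpace]
    infer_instance
  have h1 : Spec.map (CommRingCat.ofHom ((C.X.residue P.1).hom.comp P.constStalk)) =
      C.X.fromSpecResidueField P.1 ≫ C.hom := by
    rw [← Spec.map_preimage (C.X.fromSpecResidueField P.1 ≫ C.hom)]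
    congr 1
    set g := Spec.preimage (C.X.fromSpecResidueField P.1 ≫ C.hom) with hg
    have h2 : g = (Scheme.ΓSpecIso (CommRingCat.of k)).inv ≫ (Spec.map g).appTop ≫
        (Scheme.ΓSpecIso _).hom := by
      rw [Scheme.ΓSpecIso_naturality, Iso.inv_hom_id_assoc]
    rw [h2, hg, Spec.map_preimage]
    simp only [Scheme.Hom.comp_appTop, Category.assoc, Scheme.fromSpecResidueField,
      Scheme.fromSpecStalk_appTop, Scheme.ΓSpecIso_naturality]
    erw [(Spec (C.X.presheaf.stalk P.1)).presheaf.map_id, Category.id_comp,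
      Iso.inv_hom_id_assoc]
    rfl
  rw [← h1, IsFinite.SpecMap_iff] at this
  exact this

/-- `residueDegree` is taken over the residue field of Spec k at the image point; that field has to
be identified with k. -/
theorem finrank_residueField :
    letI := ((C.X.residue P.1).hom.comp P.constStalk).toAlgebra
    Module.finrank k (C.X.residueField P.1) = P.degree := by
  let e : k →+* (Spec (CommRingCat.of k)).residueField (C.hom P.1) :=
    ((Scheme.ΓSpecIso (CommRingCat.of k)).inv ≫
      (Spec (CommRingCat.of k)).Γevaluation (C.hom P.1)).hom
  have he : Function.Bijective e := by
    refine ⟨e.injective, ?_⟩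
    have h1 : Function.Surjective
        ((Spec (CommRingCat.of k)).presheaf.germ ⊤ (C.hom P.1) trivial) := by
      let := (Spec (CommRingCat.of k)).presheaf.algebra_section_stalk
        (U := ⊤) ⟨C.hom P.1, trivial⟩
      have h2 := (isAffineOpen_top (Spec (CommRingCat.of k))).isLocalization_stalk
        ⟨C.hom P.1, trivial⟩
      have h3 : IsField Γ(Spec (CommRingCat.of k), ⊤) :=
        (Scheme.ΓSpecIso (CommRingCat.of k)).commRingCatIsoToRingEquiv.toMulEquiv.isField
          (Field.toIsField k)
      exact (h3.localization_map_bijective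
        (Rₘ := (Spec (CommRingCat.of k)).presheaf.stalk (C.hom P.1)) (M := ((isAffineOpen_top (Spec (CommRingCat.of k))
        ).primeIdealOf ⟨C.hom P.1, trivial⟩).asIdeal.primeCompl) fun h => h (zero_mem _)).2
    exact ((Scheme.residue_surjective _ _).comp h1).comp
      (Scheme.ΓSpecIso (CommRingCat.of k)).symm.commRingCatIsoToRingEquiv.surjective
  let := ((C.X.residue P.1).hom.comp P.constStalk).toAlgebra
  let := (C.hom.residueFieldMap P.1).hom.toAlgebra
  refine Algebra.finrank_eq_of_equiv_equiv (RingEquiv.ofBijective e he) (RingEquiv.refl _) ?_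
  ext c
  exact Scheme.Γevaluation_naturality_apply C.hom P.1 _

theorem relDim_ordVal :
    Submodule.relDim (P.ordVal.leSubmodule P.ordVal_const_nonneg 1)
      (P.ordVal.leSubmodule P.ordVal_const_nonneg 0) = P.degree := by
  let : Algebra k (C.X.presheaf.stalk P.1) := P.constStalk.toAlgebra
  let : Algebra k (C.X.residueField P.1) :=
    ((C.X.residue P.1).hom.comp P.constStalk).toAlgebra
  have : IsScalarTower k (C.X.presheaf.stalk P.1) C.K :=
    .of_algebraMap_eq fun c => (P.algebraMap_constStalk c).symm
  have : Module.Finite k (C.X.residueField P.1) := P.finite_residue_comp_constStalk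
  let f := (IsScalarTower.toAlgHom k (C.X.presheaf.stalk P.1) C.K).toLinearMap
  have hf : Function.Injective f := IsFractionRing.injective _ _
  let r : C.X.presheaf.stalk P.1 →ₗ[k] C.X.residueField P.1 :=
    (AlgHom.mk (C.X.residue P.1).hom fun _ => rfl : _ →ₐ[k] _).toLinearMap
  have h0 : P.ordVal.leSubmodule P.ordVal_const_nonneg 0 = (⊤ : Submodule k _).map f := by
    ext x
    rw [Submodule.map_top]
    exact mem_localRing_iff.symm
  have h1 : P.ordVal.leSubmodule P.ordVal_const_nonneg 1 =
      ((⊥ : Submodule k _).comap r).map f := by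
    have key : ∀ y : C.X.presheaf.stalk P.1, 1 ≤ P.ordVal (algebraMap _ C.K y) ↔ r y = 0 := by
      intro y
      have h2 : r y = 0 ↔ ¬ IsUnit y := by
        rw [← mem_nonunits_iff, ← IsLocalRing.mem_maximalIdeal, ← IsLocalRing.residue_eq_zero_iff]
        rfl
      rw [h2, ← ordVal_algebraMap_eq_zero_iff]
      have h3 := ordVal_algebraMap_nonneg y
      generalize P.ordVal (algebraMap _ C.K y) = a at h3
      induction a using WithTop.recTopCoe with
      | top => simp
      | coe a =>
        norm_cast at *
        omega
    ext x
    constructor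
    · intro hx
      obtain ⟨y, rfl⟩ := mem_localRing_iff.2 (le_trans zero_le_one hx)
      exact ⟨y, (key y).1 hx, rfl⟩
    · rintro ⟨y, hy, rfl⟩
      exact (key y).2 hy
  rw [h0, h1, Submodule.relDim_map_of_injective f hf, Submodule.relDim_comap_left]
  have hr : (⊤ : Submodule k _).map r = ⊤ := by
    rw [Submodule.map_top]
    exact LinearMap.range_eq_top.2 (Scheme.residue_surjective _ _)
  rw [hr, Submodule.relDim_bot, Module.length_top, Module.length_eq_finrank]
  exact congrArg _ P.finrank_residueField

/-- The place of the function field at a closed point. -/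
noncomputable def place : Place k C.K where
  ord := P.ordVal
  deg := P.degree
  ord_algebraMap_nonneg := P.ordVal_const_nonneg
  exists_uniformizer := P.exists_ordVal_eq_one
  relDim_residue := P.relDim_ordVal

end ClosedPoint

end NiceCurve

/-! ### The places of the function field of a nice curve -/

namespace NiceCurve

variable {k : Type u} [Field k] (C : NiceCurve k)

open Order

instance compactSpace : CompactSpace C.X :=
  haveI := C.proper
  QuasiCompact.compactSpace_of_compactSpace C.hom

theorem specializes_closedPoint_iff {P : C.ClosedPoint} {w : C.X} (h : w ⤳ P.1) :
    w = P.1 ∨ w = genericPoint C.X := by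
  by_contra! hw
  have h1 : P.1 < w := by
    refine lt_iff_le_not_ge.2 ⟨h, fun h' => hw.1 ?_⟩
    exact (h.antisymm h').eq
  have h2 : w < genericPoint C.X := by
    have h3 : genericPoint C.X ⤳ w := genericPoint_specializes w
    exact lt_iff_le_not_ge.2 ⟨h3, fun h' => hw.2 (Specializes.antisymm h' h3).eq⟩
  have h3 := coheight_add_one_le h1
  have h4 := coheight_add_one_le h2
  rw [C.coheight_closedPoint] at h3
  have h5 : coheight w = 0 := by
    by_contra h0
    exact absurd (add_le_add_left (Order.one_le_iff_ne_zero.2 h0) 1 |>.trans h3) (by decide)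
  rw [h5] at h4
  simp at h4

/-- The complement has finitely many irreducible components. The generic point of one through P is P
itself, since the only other candidate, the generic point of the curve, lies in U. -/
theorem finite_setOf_closedPoint_notMem (U : C.X.Opens) [hU : Nonempty U] :
    {P : C.ClosedPoint | P.1 ∉ U}.Finite := by
  have : IsNoetherian C.X := {}
  obtain ⟨S, hS, hcl, hirr, hsup⟩ :=
    TopologicalSpace.NoetherianSpace.exists_finite_set_isClosed_irreducible U.2.isClosed_compl
  have hinj : Function.Injective fun P : C.ClosedPoint => ({P.1} : Set C.X) := fun P Q h =>
    Subtype.ext (Set.singleton_injective h)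
  refine (hS.preimage hinj.injOn).subset fun P hP => ?_
  obtain ⟨t, ht, hPt⟩ : P.1 ∈ ⋃₀ S := by
    rw [← hsup]
    exact hP
  have hgen := (hirr t ht).isGenericPoint_genericPoint_closure
  rw [(hcl t ht).closure_eq] at hgen
  obtain h | h := C.specializes_closedPoint_iff (hgen.specializes hPt)
  · rw [h] at hgen
    rw [Set.mem_preimage, ← P.2.closure_eq, hgen.def]
    exact ht
  · have h3 : (hirr t ht).genericPoint ∈ U.carrierᶜ := by
      rw [hsup]
      exact ⟨t, ht, hgen.mem⟩
    rw [h] at h3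
    exact absurd (((genericPoint_spec C.X).mem_open_set_iff U.2).2 (by simpa using hU)) h3

theorem finite_poles (x : C.K) : {P : C.ClosedPoint | ¬ 0 ≤ P.ordVal x}.Finite := by
  by_cases hx : x = 0
  · simp [hx]
  obtain ⟨U, -, f, hU, rfl, -⟩ := exists_isUnit_germ_eq C.X x hx
  refine (C.finite_setOf_closedPoint_notMem U).subset fun P hP hPU => hP ?_
  rw [← Scheme.algebraMap_germ_eq_germToFunctionField _ hPU]
  exact ClosedPoint.ordVal_algebraMap_nonneg _

/-- Otherwise the local ring of P lies in that of Q, giving Spec O_Q → Spec O_P → C. By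
separatedness this equals the canonical map, as both agree at the generic point; so Q specializes to
P, and Q is closed. -/
theorem exists_ordVal_separates {P Q : C.ClosedPoint} (hPQ : P ≠ Q) :
    ∃ x, 0 ≤ P.ordVal x ∧ Q.ordVal x < 0 := by
  by_contra! H
  have h1 : ∀ y : C.X.presheaf.stalk P.1, ∃ z : C.X.presheaf.stalk Q.1,
      algebraMap _ C.K z = algebraMap _ C.K y := fun y =>
    ClosedPoint.mem_localRing_iff.2 (H _ (ClosedPoint.ordVal_algebraMap_nonneg y))
  choose s hs using h1
  have hinj : Function.Injective (algebraMap (C.X.presheaf.stalk Q.1) C.K) :=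
    IsFractionRing.injective _ _
  let ψ : C.X.presheaf.stalk P.1 →+* C.X.presheaf.stalk Q.1 :=
    { toFun := s
      map_one' := hinj (by simp [hs])
      map_mul' := fun a b => hinj (by simp [hs])
      map_zero' := hinj (by simp [hs])
      map_add' := fun a b => hinj (by simp [hs]) }
  have hψ : CommRingCat.ofHom ψ ≫
      C.X.presheaf.stalkSpecializes (genericPoint_specializes Q.1) =
      C.X.presheaf.stalkSpecializes (genericPoint_specializes P.1) := by
    ext y
    exact hs y
  have := C.proper
  have : C.X.IsSeparated := ⟨Limits.terminal.comp_from C.hom ▸ inferInstance⟩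
  have hdom : IsDominant (Spec.map
      (C.X.presheaf.stalkSpecializes (genericPoint_specializes Q.1))) := by
    refine ⟨(PrimeSpectrum.denseRange_comap_iff_ker_le_nilRadical _).2 ?_⟩
    exact ((RingHom.injective_iff_ker_eq_bot _).1 hinj).trans_le bot_le
  have heq : Spec.map (CommRingCat.ofHom ψ) ≫ C.X.fromSpecStalk P.1 = C.X.fromSpecStalk Q.1 := by
    refine ext_of_isDominant
      (Spec.map (C.X.presheaf.stalkSpecializes (genericPoint_specializes Q.1))) ?_
    rw [← Category.assoc, ← Spec.map_comp, hψ, Scheme.SpecMap_stalkSpecializes_fromSpecStalk,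
      Scheme.SpecMap_stalkSpecializes_fromSpecStalk]
  have h2 : Q.1 ⤳ P.1 := by
    have h3 : Q.1 ∈ Set.range (C.X.fromSpecStalk P.1) := by
      rw [← Scheme.fromSpecStalk_closedPoint (x := Q.1), ← heq]
      exact ⟨_, rfl⟩
    rw [Scheme.range_fromSpecStalk] at h3
    exact h3
  have h3 := h2.mem_closed Q.2 rfl
  exact hPQ (Subtype.ext h3)

instance nonempty_top : Nonempty (⊤ : C.X.Opens) := ⟨⟨genericPoint C.X, trivial⟩⟩

/-- Neighbourhoods of the closed points cover C by quasi-compactness, and local sections glue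
because they agree in K. -/
theorem exists_globalSection {x : C.K} (hx : ∀ P : C.ClosedPoint, 0 ≤ P.ordVal x) :
    ∃ s : Γ(C.X, ⊤), C.X.germToFunctionField ⊤ s = x := by
  have h1 : ∀ P : C.ClosedPoint, ∃ (U : C.X.Opens) (_ : P.1 ∈ U) (_ : Nonempty U)
      (s : Γ(C.X, U)), C.X.germToFunctionField U s = x := by
    intro P
    obtain ⟨y, hy⟩ := ClosedPoint.mem_localRing_iff.2 (hx P)
    obtain ⟨U, hU, s, rfl⟩ := C.X.presheaf.exists_germ_eq y
    have : Nonempty U := ⟨⟨_, hU⟩⟩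
    refine ⟨U, hU, this, s, ?_⟩
    rw [← hy]
    exact (Scheme.algebraMap_germ_eq_germToFunctionField _ hU s).symm
  choose U hPU hU s hs using h1
  have hcover : (⊤ : C.X.Opens) ≤ iSup U := by
    intro z _
    obtain ⟨q, hq, hqc⟩ := (isClosed_closure (s := {z})).exists_closed_singleton
      ⟨z, subset_closure rfl⟩
    have h2 : z ⤳ q := specializes_iff_mem_closure.2 hq
    exact TopologicalSpace.Opens.mem_iSup.2 ⟨⟨q, hqc⟩, h2.mem_open (U ⟨q, hqc⟩).2 (hPU ⟨q, hqc⟩)⟩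
  have hgen : ∀ P, genericPoint C.X ∈ U P := fun P =>
    (genericPoint_specializes P.1).mem_open (U P).2 (hPU P)
  obtain ⟨t, ht, -⟩ := C.X.sheaf.existsUnique_gluing' U ⊤ (fun P => homOfLE le_top) hcover s (by
    intro P Q
    have : Nonempty (U P ⊓ U Q : C.X.Opens) := ⟨⟨_, hgen P, hgen Q⟩⟩
    apply C.X.germToFunctionField_injective (U P ⊓ U Q)
    trans x
    · rw [← hs P]
      exact C.X.presheaf.germ_res_apply _ _ _ _
    · rw [← hs Q]
      exact (C.X.presheaf.germ_res_apply _ _ _ _).symm)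
  refine ⟨t, ?_⟩
  obtain ⟨q, -, hqc⟩ := (isClosed_univ (X := C.X)).exists_closed_singleton ⟨genericPoint C.X, trivial⟩
  rw [← hs ⟨q, hqc⟩, ← ht ⟨q, hqc⟩]
  exact (C.X.presheaf.germ_res_apply _ _ _ _).symm

theorem finite_globalConst : C.globalConst.Finite := by
  have := C.proper
  exact (finite_appTop_of_universallyClosed k C.hom).comp
    (RingHom.Finite.of_surjective _
      (Scheme.ΓSpecIso (CommRingCat.of k)).symm.commRingCatIsoToRingEquiv.surjective)

theorem relDim_bounded_zero_ne_top :
    Submodule.relDim ⊥ (Place.bounded (fun P : C.ClosedPoint => P.place) 0) ≠ ⊤ := by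
  let : Algebra k Γ(C.X, ⊤) := C.globalConst.toAlgebra
  have : Module.Finite k Γ(C.X, ⊤) := C.finite_globalConst
  let r : Γ(C.X, ⊤) →ₗ[k] C.K :=
    (AlgHom.mk (C.X.germToFunctionField ⊤).hom fun _ => rfl : _ →ₐ[k] _).toLinearMap
  have h : Place.bounded (fun P : C.ClosedPoint => P.place) 0 ≤ LinearMap.range r := by
    intro x hx
    rw [Place.mem_bounded] at hx
    exact C.exists_globalSection fun P => by simpa using! hx P
  have h2 := Submodule.relDim_mono_right ⊥ h
  rw [Submodule.relDim_bot (LinearMap.range r), Module.length_eq_finrank] at h2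
  exact ne_top_of_le_ne_top (ENat.natCast_ne_top _) h2

theorem isComplete_place : Place.IsComplete (fun P : C.ClosedPoint => P.place) where
  separated _ _ hPQ := C.exists_ordVal_separates hPQ
  finite_poles := C.finite_poles
  finite_const := C.relDim_bounded_zero_ne_top
  finite_adjoin := C.finiteDimensional_adjoin

end NiceCurve

/-! ### Comparison of invariants -/

namespace NiceCurve

variable {k : Type u} [Field k] (C : NiceCurve k)

theorem relDim_allRepartitions_eq_genus [Nonempty C.ClosedPoint] :
    Submodule.relDim (Place.adele (fun P : C.ClosedPoint => P.place) 0 ⊔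
        LinearMap.range (Place.diag k C.K C.ClosedPoint))
      (Place.IsComplete.allRepartitions fun P : C.ClosedPoint => P.place) = (C.genus : ℕ∞) := by
  have h1 : C.repartitions =
      Place.IsComplete.allRepartitions fun P : C.ClosedPoint => P.place := by
    ext r
    change {P : C.ClosedPoint | r P ∉ P.localRing}.Finite ↔
      {P : C.ClosedPoint | ¬ 0 ≤ P.ordVal (r P)}.Finite
    simp only [ClosedPoint.mem_localRing_iff]
  have h2 : C.integralRepartitions = Place.adele (fun P : C.ClosedPoint => P.place) 0 := by
    ext r
    rw [Place.mem_adele]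
    change (∀ P : C.ClosedPoint, r P ∈ P.localRing) ↔ _
    simp only [ClosedPoint.mem_localRing_iff]
    simp [ClosedPoint.place]
  -- Finiteness is essential here: `finrank` would be 0 for an infinite-dimensional H¹.
  have hfin := C.isComplete_place.relDim_allRepartitions_ne_top
  have h3 : Submodule.relDim (Place.adele (fun P : C.ClosedPoint => P.place) 0 ⊔
        LinearMap.range (Place.diag k C.K C.ClosedPoint))
      (Place.IsComplete.allRepartitions fun P : C.ClosedPoint => P.place) =
      Module.length k C.H1 := by
    rw [← Submodule.relDim_top, Submodule.submoduleOf, Submodule.relDim_comap_left,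
      Submodule.map_subtype_top, h1, h2]
    rfl
  rw [h3] at hfin ⊢
  have := ((isFiniteLength_iff_isNoetherian_isArtinian).1 (Module.length_ne_top_iff.1 hfin)).1
  exact Module.length_eq_finrank k C.H1

variable {C}

namespace ClosedPoint

variable {P : C.ClosedPoint}

theorem deg_le_of_le_ordVal {x : C.K} {m : ℤ} (h : (m : WithTop ℤ) ≤ P.ordVal x) :
    P.deg x ≤ ((-(m * P.degree) : ℤ) : WithBot ℤ) := by
  rw [deg]
  split_ifs with hx
  · exact bot_le
  · rw [ordVal_of_ne_zero hx, WithTop.coe_le_coe] at h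
    rw [WithBot.coe_le_coe, mul_comm]
    exact neg_le_neg (mul_le_mul_of_nonneg_right h (by positivity))

theorem deg_eq_of_ordVal_eq {x : C.K} {m : ℤ} (h : P.ordVal x = m) :
    P.deg x = ((-(m * P.degree) : ℤ) : WithBot ℤ) := by
  have hx : x ≠ 0 := by
    rintro rfl
    simp at h
  rw [ordVal_of_ne_zero hx, WithTop.coe_inj] at h
  rw [deg, if_neg hx, h, mul_comm]

theorem exists_sup_deg_eq {σ : Type*} {s : Finset σ} {a : σ → C.K} (ha : ∃ e ∈ s, a e ≠ 0)
    (P : C.ClosedPoint) :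
    ∃ m : ℤ, (∀ e ∈ s, (m : WithTop ℤ) ≤ P.ordVal (a e)) ∧ (∃ e ∈ s, P.ordVal (a e) = m) ∧
      (s.sup fun e => P.deg (a e)) = ((-(m * P.degree) : ℤ) : WithBot ℤ) := by
  obtain ⟨e₀, he₀, h₀⟩ := ha
  obtain ⟨e, he, hmin⟩ := s.exists_min_image (fun e => P.ordVal (a e)) ⟨e₀, he₀⟩
  have hne : P.ordVal (a e) ≠ ⊤ := by
    intro h
    have := hmin e₀ he₀
    rw [h, top_le_iff, P.ordVal.top_iff] at this
    exact h₀ this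
  obtain ⟨m, hm⟩ := WithTop.ne_top_iff_exists.1 hne
  refine ⟨m, fun e' he' => hm.trans_le (hmin e' he'), ⟨e, he, hm.symm⟩, le_antisymm ?_ ?_⟩
  · exact Finset.sup_le fun e' he' => deg_le_of_le_ordVal (hm.trans_le (hmin e' he'))
  · rw [← deg_eq_of_ordVal_eq hm.symm]
    exact Finset.le_sup (f := fun e => P.deg (a e)) he

end ClosedPoint

theorem mem_coordRing_iff {S : Finset C.ClosedPoint} {x : C.K} :
    x ∈ C.coordRing S ↔ ∀ P ∉ S, 0 ≤ P.ordVal x := by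
  simp only [coordRing, Algebra.mem_iInf, ClosedPoint.mem_localRing_iff, Subtype.forall]

theorem exists_sum_sup_deg_eq {σ : Type*} {s : Finset σ} {a : σ → C.K}
    (ha : ∃ e ∈ s, a e ≠ 0) (S : Finset C.ClosedPoint) :
    ∃ μ : C.ClosedPoint → ℤ, (∀ P, ∀ e ∈ s, (μ P : WithTop ℤ) ≤ P.ordVal (a e)) ∧
      (∀ P, ∃ e ∈ s, P.ordVal (a e) = μ P) ∧
      ∑ P ∈ S, (s.sup fun e => P.deg (a e)) =
        ((-∑ P ∈ S, μ P * (P.degree : ℤ) : ℤ) : WithBot ℤ) := by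
  choose μ h1 h2 h3 using ClosedPoint.exists_sup_deg_eq ha
  refine ⟨μ, h1, h2, ?_⟩
  rw [Finset.sum_congr rfl fun P _ => h3 P, ← Finset.sum_neg_distrib, WithBot.coe_sum]

end NiceCurve

theorem corollary6p3 {k : Type u} [Field k] (C : NiceCurve k)
    (S : Finset C.ClosedPoint) (hS : S.Nonempty)
    (n : ℕ) (f : MvPolynomial (Fin n) (C.coordRing S))
    (hf : f.IsHomogeneous 2) (hf0 : f ≠ 0)
    (hiso : ∃ w : Fin n → C.coordRing S, w ≠ 0 ∧ MvPolynomial.eval w f = 0) :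
    ∃ v : Fin n → C.coordRing S, v ≠ 0 ∧ MvPolynomial.eval v f = 0 ∧
      ∃ a b : ℤ, NiceCurve.vecDeg v = a ∧ NiceCurve.formDeg f = b ∧
        (a : ℚ) ≤ ((∑ P ∈ S, (P.degree : ℚ)) + C.genus - 1) * n + ((n : ℚ) - 1) / 2 * b := by
  obtain ⟨w₀, hw₀, hw₀f⟩ := hiso
  have hn : Nonempty (Fin n) := by
    obtain ⟨l, -⟩ := Function.ne_iff.1 hw₀
    exact ⟨l⟩
  have hP : Nonempty C.ClosedPoint := hS.to_type
  obtain ⟨i, j, hij⟩ := hf.exists_eval_eq_quadEval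
  let c : (Fin n →₀ ℕ) → C.K := fun d => (f.coeff d : C.coordRing S)
  have hfc : ∀ v : Fin n → C.coordRing S, MvPolynomial.eval v f = 0 ↔
      quadEval f.support c i j (fun l => (v l : C.K)) = 0 := by
    intro v
    rw [hij, ← ZeroMemClass.coe_eq_zero]
    simp [quadEval, c]
  have hc0 : ∃ e ∈ f.support, c e ≠ 0 := by
    obtain ⟨d, hd⟩ := MvPolynomial.support_nonempty.2 hf0
    exact ⟨d, hd, by simpa [c] using hd⟩
  have hv0 : ∀ v : Fin n → C.coordRing S, v ≠ 0 → ∃ l ∈ Finset.univ, (v l : C.K) ≠ 0 := by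
    intro v hv
    obtain ⟨l, hl⟩ := Function.ne_iff.1 hv
    exact ⟨l, Finset.mem_univ l, by simpa using hl⟩
  obtain ⟨φ, hφ, -, hφf⟩ := NiceCurve.exists_sum_sup_deg_eq hc0 S
  -- The minimum is taken over lower bounds μ for the orders, not over exact degrees, since the
  -- descent step returns only such bounds.
  let T : Set ℕ := {N | ∃ v : Fin n → C.coordRing S, v ≠ 0 ∧ MvPolynomial.eval v f = 0 ∧
    ∃ μ : C.ClosedPoint → ℤ, (∀ P ∈ S, ∀ l, (μ P : WithTop ℤ) ≤ P.ordVal (v l : C.K)) ∧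
      -∑ P ∈ S, μ P * (P.degree : ℤ) = N}
  have hT : ∀ (v : Fin n → C.coordRing S), v ≠ 0 → MvPolynomial.eval v f = 0 →
      ∀ μ : C.ClosedPoint → ℤ, (∀ P ∈ S, ∀ l, (μ P : WithTop ℤ) ≤ P.ordVal (v l : C.K)) →
      (-∑ P ∈ S, μ P * (P.degree : ℤ)).toNat ∈ T ∧ 0 ≤ -∑ P ∈ S, μ P * (P.degree : ℤ) := by
    intro v hv hvf μ hμ
    obtain ⟨l, -, hl⟩ := hv0 v hv
    have h1 : 0 ≤ -∑ P ∈ S, μ P * (P.degree : ℤ) := neg_nonneg.2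
      (C.isComplete_place.sum_deg_mul_ord_nonpos hl
        (NiceCurve.mem_coordRing_iff.1 (v l).2) fun P hP => hμ P hP l)
    exact ⟨⟨v, hv, hvf, μ, hμ, (Int.toNat_of_nonneg h1).symm⟩, h1⟩
  have hTne : T.Nonempty := by
    obtain ⟨μ, hμ, -, -⟩ := NiceCurve.exists_sum_sup_deg_eq (hv0 w₀ hw₀) S
    exact ⟨_, (hT w₀ hw₀ hw₀f μ fun P _ l => hμ P l (Finset.mem_univ l)).1⟩
  obtain ⟨v, hv, hvf, μ, hμ, hN⟩ := Nat.sInf_mem hTne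
  -- The exact minimal orders of v; they are at least μ on S, so the true degree of v is at most the
  -- minimum.
  obtain ⟨μ', -, hμ', hvdeg⟩ := NiceCurve.exists_sum_sup_deg_eq (hv0 v hv) S
  refine ⟨v, hv, hvf, _, _, hvdeg, hφf, ?_⟩
  have hle : ∑ P ∈ S, μ P * (P.degree : ℤ) ≤ ∑ P ∈ S, μ' P * (P.degree : ℤ) := by
    refine Finset.sum_le_sum fun P hP => mul_le_mul_of_nonneg_right ?_ (by positivity)
    obtain ⟨l, -, hl⟩ := hμ' P
    have := hμ P hP l
    rwa [hl, WithTop.coe_le_coe] at this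
  have hshort : -2 * ∑ P ∈ S, μ P * (P.degree : ℤ) ≤
      2 * (∑ P ∈ S, (P.degree : ℤ) + C.genus - 1) * n -
        (n - 1) * ∑ P ∈ S, φ P * (P.degree : ℤ) := by
    by_contra! hlong
    obtain ⟨w, hw, hwq, hwS, ν, hν, hlt⟩ := C.isComplete_place.exists_shorter_isotropic
      C.relDim_allRepartitions_eq_genus hS
      (fun P hP e _ => NiceCurve.mem_coordRing_iff.1 (f.coeff e).2 P hP) hc0
      (fun P _ => hφ P) (a := fun l => (v l : C.K))
      (fun h => hv (funext fun l => Subtype.ext (congr_fun h l))) ((hfc v).1 hvf)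
      (fun P hP l => NiceCurve.mem_coordRing_iff.1 (v l).2 P hP) hμ hlong
    let w' : Fin n → C.coordRing S := fun l =>
      ⟨w l, NiceCurve.mem_coordRing_iff.2 fun P hP => hwS P hP l⟩
    have h1 := hT w' (fun h => hw (funext fun l => congr_arg Subtype.val (congr_fun h l)))
      ((hfc w').2 hwq) ν hν
    have h2 := Nat.sInf_le h1.1
    have h3 : ∑ P ∈ S, μ P * (P.degree : ℤ) < ∑ P ∈ S, ν P * (P.degree : ℤ) := hlt
    omega
  have hle' : -(∑ P ∈ S, μ' P * (P.degree : ℤ) : ℚ) ≤ -(∑ P ∈ S, μ P * (P.degree : ℤ) : ℚ) :=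
    neg_le_neg (by exact_mod_cast hle)
  have hshort' : -2 * (∑ P ∈ S, μ P * (P.degree : ℤ) : ℚ) ≤
      2 * (∑ P ∈ S, (P.degree : ℚ) + C.genus - 1) * n -
        (n - 1) * (∑ P ∈ S, φ P * (P.degree : ℤ) : ℚ) := by
    exact_mod_cast hshort
  push_cast at hle' hshort' ⊢
  linarith
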